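/- **Setting.** Let $\Theta\subseteq\mathbb R^d$ be closed and convex, and let $p$ be a probability density on $\Theta$ that is positive and differentiable on $\operatorname{int}\Theta$. Let $\psi$ be a $C^2$, $\alpha$-strongly convex function on $\operatorname{int}\Theta$ ($\alpha>0$) which is essentially smooth, i.e. $\|\nabla\psi(\theta)\|_2\to\infty$ whenever $\theta\in\operatorname{int}\Theta$ tends to a point of $\partial\Theta$, and such that $\theta\mapsto\nabla^2\psi(\theta)^{-1}$ is differentiable on $\operatorname{int}\Theta$. Let $\psi^*(\eta)=\sup_{\theta\in\operatorname{int}\Theta}\{\eta^\top\theta-\psi(\theta)\}$ be its convex conjugate, and let $p_H(\eta)=p(\nabla\psi^*(\eta))\,|\det\nabla^2\psi^*(\eta)|$ be the mirrored density on $\mathbb R^d$. For a vector field $g$ put $$(\mathcal M_{p,\psi}g)(\theta)=g(\theta)^\top\nabla^2\psi(\theta)^{-1}\nabla\log p(\theta)+\nabla\cdot\big(\nabla^2\psi(\theta)^{-1}g(\theta)\big).$$ Let $K(\theta,\theta')\in\mathbb R^{d\times d}$ be a matrix-valued positive definite kernel on $\operatorname{int}\Theta$, with RKHS $\mathcal H_K$,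 whose mixed second partial derivatives $\partial_{\theta_i}\partial_{\theta'_j}K(\theta,\theta')$ exist and are continuous. For a probability measure $q$ define $$g^*_{q,K}(\theta')=\mathbb E_{\theta\sim q}\big[\mathcal M_{p,\psi}K(\theta',\theta)\big],\qquad \mathrm{MKSD}_K(q,p)=\sup_{\|g\|_{\mathcal H_K}\le 1}\mathbb E_{q}\big[\mathcal M_{p,\psi}g\big],$$ where $\mathcal M_{p,\psi}$ acts, in the variable $\theta$, on each row of $K(\theta',\theta)$. With step size $\epsilon_t>0$, kernel $K_t$ (which may depend on $q_t$) and current law $q_t$, one infinite-particle mirrored Stein update produces the law $q_{t+1}$ of $$\theta_{t+1}=\nabla\psi^*\big(\nabla\psi(\theta_t)+\epsilon_t\,g^*_{q_t,K_t}(\theta_t)\big),\qquad \theta_t\sim q_t .$$ **Theorem (Infinite-particle mirrored Stein updates decrease KL and MKSD).** Assume $\mathrm{KL}(q_t\|p)<\infty$, $$\kappa_1:=\sup_{\theta}\|K_t(\theta,\theta)\|_{\mathrm{op}}<\infty,\qquad \kappa_2:=\sum_{i=1}^d\sup_{\theta}\big\|\partial_{\theta_i}\partial_{\theta'_i}K_t(\theta,\theta')|_{\theta'=\theta}\big\|_{\mathrm{op}}<\infty$$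 (suprema over $\operatorname{int}\Theta$), that $\nabla\log p_H$ is $L$-Lipschitz on $\mathbb R^d$, and that $$\epsilon_t<\frac{1}{2\sup_{\theta}\big\|\nabla^2\psi(\theta)^{-1}\nabla g^*_{q_t,K_t}(\theta)+\nabla g^*_{q_t,K_t}(\theta)^\top\nabla^2\psi(\theta)^{-1}\big\|_{\mathrm{op}}},$$ where $(\nabla g)_{ij}=\partial_i g_j$, $1/0=\infty$ and $1/\infty=0$. Then $\mathcal M_{p,\psi}g$ is $q_t$-integrable for every $g\in\mathcal H_{K_t}$, $\mathrm{MKSD}_{K_t}(q_t,p)<\infty$, $q_{t+1}$ is a probability measure with $\mathrm{KL}(q_{t+1}\|p)<\infty$, and $$\mathrm{KL}(q_{t+1}\|p)-\mathrm{KL}(q_t\|p)\le-\Big(\epsilon_t-\Big(\frac{L\kappa_1}{2}+\frac{2\kappa_2}{\alpha^2}\Big)\epsilon_t^2\Big)\,\mathrm{MKSD}_{K_t}(q_t,p)^2 .$$ -/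

import Mathlib

open MeasureTheory Set Filter Topology
open scoped NNReal ENNReal InnerProductSpace

noncomputable section

namespace MirroredStein

variable {d : ℕ}

/-- The `i`-th standard basis vector of `ℝᵈ`. -/
def stdVec (i : Fin d) : EuclideanSpace ℝ (Fin d) := EuclideanSpace.single i 1

/-- The Hessian `∇²f(x)`, as the linear map `v ↦ D(∇f)(x) v`. -/
def hess (f : EuclideanSpace ℝ (Fin d) → ℝ) (x : EuclideanSpace ℝ (Fin d)) :
    EuclideanSpace ℝ (Fin d) →L[ℝ] EuclideanSpace ℝ (Fin d) :=
  fderiv ℝ (gradient f) x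

/-- The inverse Hessian `∇²f(x)⁻¹`. -/
def invHess (f : EuclideanSpace ℝ (Fin d) → ℝ) (x : EuclideanSpace ℝ (Fin d)) :
    EuclideanSpace ℝ (Fin d) →L[ℝ] EuclideanSpace ℝ (Fin d) :=
  (hess f x).inverse

/-- The divergence `∑ᵢ ∂ᵢ vᵢ` of a vector field. -/
def divergence (v : EuclideanSpace ℝ (Fin d) → EuclideanSpace ℝ (Fin d))
    (x : EuclideanSpace ℝ (Fin d)) : ℝ :=
  ∑ i, fderiv ℝ v x (stdVec i) i

/-- The matrix `(∇g)ᵢⱼ = ∂ᵢ gⱼ`, i.e. the transpose of the Jacobian matrix. With this convention the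
chain rule reads `∇_η g = ∇²ψ*(η) ∇g(θ)` for `θ = ∇ψ*(η)`. -/
def gradField (g : EuclideanSpace ℝ (Fin d) → EuclideanSpace ℝ (Fin d))
    (x : EuclideanSpace ℝ (Fin d)) :
    EuclideanSpace ℝ (Fin d) →L[ℝ] EuclideanSpace ℝ (Fin d) :=
  ContinuousLinearMap.adjoint (fderiv ℝ g x)

/-- `ψ` is essentially smooth on `Θ`: it is continuously differentiable on the interior of `Θ`, and
`‖∇ψ(θ)‖ → ∞` as `θ` tends to a boundary point of `Θ` from the interior. -/
def EssentiallySmooth (Θ : Set (EuclideanSpace ℝ (Fin d)))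
    (ψ : EuclideanSpace ℝ (Fin d) → ℝ) : Prop :=
  ContDiffOn ℝ 1 ψ (interior Θ) ∧
    ∀ θ₀ ∈ frontier Θ, Tendsto (fun θ => ‖gradient ψ θ‖) (𝓝[interior Θ] θ₀) atTop

/-- The convex conjugate `ψ*(η) = sup_θ (⟪η, θ⟫ - ψ θ)`. The supremum runs over the interior of `Θ`,
so that the values which a convex `ψ : Θ → ℝ ∪ {∞}` takes on the boundary do not matter: by
convexity they do not change the supremum. -/
def conjugate (Θ : Set (EuclideanSpace ℝ (Fin d))) (ψ : EuclideanSpace ℝ (Fin d) → ℝ)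
    (η : EuclideanSpace ℝ (Fin d)) : ℝ :=
  sSup ((fun θ => ⟪η, θ⟫_ℝ - ψ θ) '' interior Θ)

/-- The target distribution: the measure on `Θ` with Lebesgue density `p`. -/
def target (Θ : Set (EuclideanSpace ℝ (Fin d))) (p : EuclideanSpace ℝ (Fin d) → ℝ) :
    Measure (EuclideanSpace ℝ (Fin d)) :=
  (volume.restrict Θ).withDensity (fun θ => ENNReal.ofReal (p θ))

/-- The mirrored density `p_H(η) = p(∇ψ*(η)) |det ∇²ψ*(η)|`. -/
def mirroredDensity (Θ : Set (EuclideanSpace ℝ (Fin d)))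
    (p ψ : EuclideanSpace ℝ (Fin d) → ℝ) (η : EuclideanSpace ℝ (Fin d)) : ℝ :=
  p (gradient (conjugate Θ ψ) η) * |(hess (conjugate Θ ψ) η).det|

/-- The mirrored Stein operator
`(M_{p,ψ} g)(θ) = g(θ)ᵀ ∇²ψ(θ)⁻¹ ∇ log p(θ) + ∇ · (∇²ψ(θ)⁻¹ g(θ))`. -/
def steinOp (p ψ : EuclideanSpace ℝ (Fin d) → ℝ)
    (g : EuclideanSpace ℝ (Fin d) → EuclideanSpace ℝ (Fin d))
    (θ : EuclideanSpace ℝ (Fin d)) : ℝ :=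
  ⟪g θ, invHess ψ θ (gradient (fun x => Real.log (p x)) θ)⟫_ℝ
    + divergence (fun x => invHess ψ x (g x)) θ

/-- The direction `g*_{q,K}(θ') = E_{θ ∼ q}[M_{p,ψ} K(θ', θ)]`, where `M_{p,ψ}` is applied, in the
variable `θ`, to each row of the matrix `K(θ', θ)`; the `i`-th row is `K(θ', θ)ᵀ eᵢ`. -/
def direction (p ψ : EuclideanSpace ℝ (Fin d) → ℝ)
    (K : EuclideanSpace ℝ (Fin d) → EuclideanSpace ℝ (Fin d) →
      (EuclideanSpace ℝ (Fin d) →L[ℝ] EuclideanSpace ℝ (Fin d)))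
    (q : Measure (EuclideanSpace ℝ (Fin d))) (θ' : EuclideanSpace ℝ (Fin d)) :
    EuclideanSpace ℝ (Fin d) :=
  WithLp.toLp 2 fun i =>
    ∫ θ, steinOp p ψ (fun x => ContinuousLinearMap.adjoint (K θ' x) (stdVec i)) θ ∂q

/-- One infinite-particle mirrored Stein update: the law of `θ⁺ = ∇ψ*(∇ψ(θ) + ε g*_{q,K}(θ))` when
`θ ∼ q`. -/
def update (Θ : Set (EuclideanSpace ℝ (Fin d))) (p ψ : EuclideanSpace ℝ (Fin d) → ℝ)
    (K : EuclideanSpace ℝ (Fin d) → EuclideanSpace ℝ (Fin d) →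
      (EuclideanSpace ℝ (Fin d) →L[ℝ] EuclideanSpace ℝ (Fin d)))
    (ε : ℝ) (q : Measure (EuclideanSpace ℝ (Fin d))) :
    Measure (EuclideanSpace ℝ (Fin d)) :=
  q.map fun θ => gradient (conjugate Θ ψ) (gradient ψ θ + ε • direction p ψ K q θ)

/-- The mixed second partial derivative `∂_{xᵢ} ∂_{yⱼ} K(x, y)` of a matrix-valued kernel; its
diagonal value `x = y = θ` with `j = i` is `∇²_{i,d+i} K(θ, θ)`. -/
def mixedPartial (K : EuclideanSpace ℝ (Fin d) → EuclideanSpace ℝ (Fin d) →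
      (EuclideanSpace ℝ (Fin d) →L[ℝ] EuclideanSpace ℝ (Fin d)))
    (i j : Fin d) (x y : EuclideanSpace ℝ (Fin d)) :
    EuclideanSpace ℝ (Fin d) →L[ℝ] EuclideanSpace ℝ (Fin d) :=
  fderiv ℝ (fun x' => fderiv ℝ (K x') y (stdVec j)) x (stdVec i)

/-- The mixed second derivatives `∂_{xᵢ} ∂_{yⱼ} K(x, y)` exist and are continuous on `U × U`
(this holds for every kernel of class `C²`). -/
structure MixedC1 (U : Set (EuclideanSpace ℝ (Fin d)))
    (K : EuclideanSpace ℝ (Fin d) → EuclideanSpace ℝ (Fin d) →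
      (EuclideanSpace ℝ (Fin d) →L[ℝ] EuclideanSpace ℝ (Fin d))) : Prop where
  diff_right : ∀ x ∈ U, DifferentiableOn ℝ (K x) U
  diff_left : ∀ j, ∀ y ∈ U, DifferentiableOn ℝ (fun x => fderiv ℝ (K x) y (stdVec j)) U
  cont : ∀ i j, ContinuousOn
    (fun z : EuclideanSpace ℝ (Fin d) × EuclideanSpace ℝ (Fin d) =>
      mixedPartial K i j z.1 z.2) (U ×ˢ U)

/-- `κ₁ = sup_θ ‖K(θ, θ)‖_op` over `θ ∈ U`. -/
def kappa₁ (U : Set (EuclideanSpace ℝ (Fin d)))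
    (K : EuclideanSpace ℝ (Fin d) → EuclideanSpace ℝ (Fin d) →
      (EuclideanSpace ℝ (Fin d) →L[ℝ] EuclideanSpace ℝ (Fin d))) : ℝ :=
  sSup ((fun θ => ‖K θ θ‖) '' U)

/-- `κ₂ = ∑ᵢ sup_θ ‖∇²_{i,d+i} K(θ, θ)‖_op` over `θ ∈ U`. -/
def kappa₂ (U : Set (EuclideanSpace ℝ (Fin d)))
    (K : EuclideanSpace ℝ (Fin d) → EuclideanSpace ℝ (Fin d) →
      (EuclideanSpace ℝ (Fin d) →L[ℝ] EuclideanSpace ℝ (Fin d))) : ℝ :=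
  ∑ i, sSup ((fun θ => ‖mixedPartial K i i θ θ‖) '' U)

section RKHS

variable {Θ : Set (EuclideanSpace ℝ (Fin d))} {H : Type*} [NormedAddCommGroup H]
  [InnerProductSpace ℝ H] [RKHS ℝ H (interior Θ) (EuclideanSpace ℝ (Fin d))]

/-- An element of an RKHS of vector fields on the interior of `Θ`, as a function on `ℝᵈ`
(by the value `0` outside of the interior of `Θ`, which plays no role). -/
def toField (f : H) : EuclideanSpace ℝ (Fin d) → EuclideanSpace ℝ (Fin d) :=
  Function.extend Subtype.val (fun θ : interior Θ => f θ) 0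

variable (H) in
/-- The set of the numbers `E_q[M_{p,ψ} g]`, for `g` in the unit ball of the RKHS `H`. -/
def steinValues (p ψ : EuclideanSpace ℝ (Fin d) → ℝ)
    (q : Measure (EuclideanSpace ℝ (Fin d))) : Set ℝ :=
  {r | ∃ f : H, ‖f‖ ≤ 1 ∧ r = ∫ θ, steinOp p ψ (toField f) θ ∂q}

variable (H) in
/-- The mirrored kernel Stein discrepancy `sup_{‖g‖_H ≤ 1} E_q[M_{p,ψ} g]`. -/
def mksd (p ψ : EuclideanSpace ℝ (Fin d) → ℝ)
    (q : Measure (EuclideanSpace ℝ (Fin d))) : ℝ :=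
  sSup (steinValues H p ψ q)

end RKHS

end MirroredStein

end

/-! In the dual coordinates η = ∇ψ(θ) the mirrored update is a perturbation of the identity on ℝᵈ.
Strong convexity and essential smoothness make ∇ψ a bijection of int Θ onto ℝᵈ with inverse ∇ψ*
(`IsMirror.image_gradient`). KL is invariant under it, the target becomes exp V with V = log p_H,
and the mirrored Stein operator of g becomes the ordinary one, ⟪∇V, w⟫ + tr Dw with w = g ∘ ∇ψ*
(`IsMirror.steinOp_eq`).

Finite relative entropy and a sub-Gaussian score make ∇V integrable, so f ↦ E_q[M f] is a bounded
functional on H. Its Riesz representer g has norm MKSD, and the reproducing property identifies it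
with the direction g*. The update is therefore φ = id + W with W = ε g ∘ ∇ψ*, and the mean of the
Stein operator at W is ε ‖g‖² = ε MKSD².

Since KL(φ_*Q ‖ exp V) = KL(Q ‖ r exp V) with r = exp(V ∘ φ - V) |det Dφ|, the change of KL is
-E_Q[log r] (`klDiv_map_id_add_le`). The Lipschitz score gives V ∘ φ - V ≥ ⟪∇V, W⟫ - (L/2)‖W‖², and
`log_abs_det_one_add_bounds` gives log |det(1 + DW)| ≥ tr DW - 2‖DW‖² in Hilbert-Schmidt norm. Both
the invertibility of φ and the determinant estimate need only the symmetric part of DW to be at most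
1/4, which is the step size condition. The bounds ‖W‖² ≤ ε²κ₁‖g‖² and ‖DW‖² ≤ ε²κ₂‖g‖²/α² finish the
proof. The second one needs elements of H to be differentiable, which is deduced from second
differences of K (`exists_hasFDerivAt_feature`). -/

noncomputable section

namespace MirroredStein

section

/-! ### Strong convexity, strong monotonicity and coercive derivatives. -/

section StrongConvexity

variable {E : Type*} [NormedAddCommGroup E] [InnerProductSpace ℝ E] [CompleteSpace E]
  {U : Set E} {f : E → ℝ} {α : ℝ} {x y : E}

/-- The first-order characterisation of strong convexity. -/
theorem add_inner_gradient_le_of_strongConvexOn (hf : StrongConvexOn U α f)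
    (hx : x ∈ U) (hy : y ∈ U) (hd : DifferentiableAt ℝ f x) :
    f x + ⟪gradient f x, y - x⟫_ℝ + α / 2 * ‖y - x‖ ^ 2 ≤ f y := by
  have hline : HasDerivAt (fun t : ℝ => f (x + t • (y - x))) (fderiv ℝ f x (y - x)) 0 := by
    have h1 : HasDerivAt (fun t : ℝ => x + t • (y - x)) (y - x) 0 := by
      simpa using ((hasDerivAt_id (0 : ℝ)).smul_const (y - x)).const_add x
    have h2 : HasFDerivAt f (fderiv ℝ f x) (x + (0 : ℝ) • (y - x)) := by
      simpa using hd.hasFDerivAt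
    exact h2.comp_hasDerivAt (0 : ℝ) h1
  have htend := hline.tendsto_slope_zero_right
  have hrhs : Tendsto (fun t : ℝ => f y - f x - (1 - t) * (α / 2 * ‖y - x‖ ^ 2)) (𝓝[>] 0)
      (𝓝 (f y - f x - (1 - 0) * (α / 2 * ‖y - x‖ ^ 2))) := by
    refine Tendsto.mono_left (Continuous.tendsto ?_ _) nhdsWithin_le_nhds
    fun_prop
  -- The convexity inequality on the segment, divided by t; the first-order inequality is its limit
  -- as t ↓ 0.
  have hle : ∀ᶠ t : ℝ in 𝓝[>] 0, t⁻¹ • (f (x + (0 + t) • (y - x)) - f (x + (0 : ℝ) • (y - x)))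
      ≤ f y - f x - (1 - t) * (α / 2 * ‖y - x‖ ^ 2) := by
    filter_upwards [Ioo_mem_nhdsGT (zero_lt_one' ℝ)] with t ht
    have h := hf.2 hx hy (sub_nonneg.2 ht.2.le) ht.1.le (sub_add_cancel 1 t)
    have e : (1 - t) • x + t • y = x + (0 + t) • (y - x) := by
      rw [zero_add, smul_sub, sub_smul, one_smul]; abel
    rw [e, norm_sub_rev] at h
    simp only [smul_eq_mul, zero_smul, add_zero] at h ⊢
    rw [inv_mul_le_iff₀ ht.1]
    linarith
  have := le_of_tendsto_of_tendsto htend hrhs hle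
  rw [inner_gradient_left]
  linarith

theorem mul_sq_le_inner_gradient_sub (hf : StrongConvexOn U α f) (hx : x ∈ U) (hy : y ∈ U)
    (hdx : DifferentiableAt ℝ f x) (hdy : DifferentiableAt ℝ f y) :
    α * ‖x - y‖ ^ 2 ≤ ⟪gradient f x - gradient f y, x - y⟫_ℝ := by
  have h1 := add_inner_gradient_le_of_strongConvexOn hf hx hy hdx
  have h2 := add_inner_gradient_le_of_strongConvexOn hf hy hx hdy
  rw [inner_sub_left]
  have e : ⟪gradient f x, y - x⟫_ℝ = - ⟪gradient f x, x - y⟫_ℝ := by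
    rw [← neg_sub x y, inner_neg_right]
  rw [norm_sub_rev y x] at h1
  linarith

end StrongConvexity

section Monotone

variable {E : Type*} [NormedAddCommGroup E] [InnerProductSpace ℝ E] {c : ℝ}

theorem mul_norm_le_of_mul_sq_le_inner {v w : E} (h : c * ‖v‖ ^ 2 ≤ ⟪w, v⟫_ℝ) :
    c * ‖v‖ ≤ ‖w‖ := by
  rcases eq_or_ne v 0 with rfl | hv
  · simp
  · have h1 := real_inner_le_norm w v
    have h2 : 0 < ‖v‖ := norm_pos_iff.2 hv
    nlinarith

/-- The derivative of a strongly monotone map is coercive. -/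
theorem mul_sq_le_inner_of_hasFDerivAt {U : Set E} {F : E → E} {F' : E →L[ℝ] E} {x : E}
    (hU : U ∈ 𝓝 x) (hF : ∀ y ∈ U, c * ‖y - x‖ ^ 2 ≤ ⟪F y - F x, y - x⟫_ℝ)
    (hd : HasFDerivAt F F' x) (v : E) : c * ‖v‖ ^ 2 ≤ ⟪F' v, v⟫_ℝ := by
  have h1 : HasDerivAt (fun t : ℝ => x + t • v) v 0 := by
    simpa using ((hasDerivAt_id (0 : ℝ)).smul_const v).const_add x
  have h2 : HasFDerivAt F F' (x + (0 : ℝ) • v) := by simpa using hd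
  have h3 := (h2.comp_hasDerivAt (0 : ℝ) h1).tendsto_slope_zero_right
  have h4 : Tendsto (fun t : ℝ => ⟪t⁻¹ • (F (x + (0 + t) • v) - F (x + (0 : ℝ) • v)), v⟫_ℝ)
      (𝓝[>] 0) (𝓝 ⟪F' v, v⟫_ℝ) := h3.inner tendsto_const_nhds
  refine ge_of_tendsto h4 ?_
  have h5 : ∀ᶠ t : ℝ in 𝓝[>] 0, x + t • v ∈ U := by
    refine (h1.continuousAt.tendsto.mono_left nhdsWithin_le_nhds).eventually ?_
    simpa using hU
  filter_upwards [h5, self_mem_nhdsWithin] with t ht htp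
  have htp : 0 < t := htp
  have h6 := hF _ ht
  simp only [add_sub_cancel_left, norm_smul, inner_smul_right, Real.norm_eq_abs,
    abs_of_pos htp] at h6
  simp only [zero_add, zero_smul, add_zero, real_inner_smul_left]
  rw [le_inv_mul_iff₀ htp]
  nlinarith

variable [FiniteDimensional ℝ E]

/-- A coercive linear map of a finite-dimensional space as an equivalence. -/
theorem exists_equiv_of_coercive (hc : 0 < c) {F : E →L[ℝ] E}
    (hF : ∀ v, c * ‖v‖ ^ 2 ≤ ⟪F v, v⟫_ℝ) : ∃ e : E ≃L[ℝ] E, (e : E →L[ℝ] E) = F := by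
  have hinj : Function.Injective (F : E →ₗ[ℝ] E) := by
    rw [injective_iff_map_eq_zero]
    intro v hv
    have h := mul_norm_le_of_mul_sq_le_inner (hF v)
    have hv' : F v = 0 := hv
    rw [hv', norm_zero] at h
    exact norm_le_zero_iff.1 (by nlinarith [norm_nonneg v])
  refine ⟨(LinearEquiv.ofInjectiveEndo (F : E →ₗ[ℝ] E) hinj).toContinuousLinearEquiv, ?_⟩
  ext v
  rfl

theorem norm_inverse_le_of_coercive (hc : 0 < c) {F : E →L[ℝ] E}
    (hF : ∀ v, c * ‖v‖ ^ 2 ≤ ⟪F v, v⟫_ℝ) : ‖F.inverse‖ ≤ c⁻¹ := by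
  obtain ⟨e, rfl⟩ := exists_equiv_of_coercive hc hF
  rw [ContinuousLinearMap.inverse_equiv]
  refine ContinuousLinearMap.opNorm_le_bound _ (inv_nonneg.2 hc.le) fun w => ?_
  have h := mul_norm_le_of_mul_sq_le_inner (hF (e.symm w))
  simp only [ContinuousLinearEquiv.coe_coe, ContinuousLinearEquiv.apply_symm_apply] at h ⊢
  rwa [← mul_le_mul_iff_right₀ hc, mul_inv_cancel_left₀ hc.ne']

end Monotone

/-! ### The mirror map ∇ψ and its inverse ∇ψ*. -/

variable {d : ℕ}

/-- The standing assumptions on the mirror function `ψ` over the convex set `Θ`. -/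
structure IsMirror (Θ : Set (EuclideanSpace ℝ (Fin d))) (ψ : EuclideanSpace ℝ (Fin d) → ℝ)
    (α : ℝ) : Prop where
  closed : IsClosed Θ
  convex : Convex ℝ Θ
  nonempty : (interior Θ).Nonempty
  pos : 0 < α
  strongConvex : StrongConvexOn (interior Θ) α ψ
  smooth : EssentiallySmooth Θ ψ
  contDiff : ContDiffOn ℝ 2 ψ (interior Θ)

namespace IsMirror

variable {Θ : Set (EuclideanSpace ℝ (Fin d))} {ψ : EuclideanSpace ℝ (Fin d) → ℝ} {α : ℝ}
  {θ θ' η : EuclideanSpace ℝ (Fin d)}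

theorem contDiffAt (h : IsMirror Θ ψ α) (hθ : θ ∈ interior Θ) : ContDiffAt ℝ 2 ψ θ :=
  h.contDiff.contDiffAt (isOpen_interior.mem_nhds hθ)

theorem differentiableAt (h : IsMirror Θ ψ α) (hθ : θ ∈ interior Θ) : DifferentiableAt ℝ ψ θ :=
  (h.contDiffAt hθ).differentiableAt (by norm_num)

theorem contDiffAt_gradient (h : IsMirror Θ ψ α) (hθ : θ ∈ interior Θ) :
    ContDiffAt ℝ 1 (gradient ψ) θ := by
  have h1 : ContDiffAt ℝ 1 (fderiv ℝ ψ) θ := (h.contDiffAt hθ).fderiv_right (by norm_num)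
  exact (InnerProductSpace.toDual ℝ (EuclideanSpace ℝ (Fin d))).symm.toContinuousLinearEquiv
    |>.contDiff.contDiffAt.comp θ h1

theorem hasFDerivAt_gradient (h : IsMirror Θ ψ α) (hθ : θ ∈ interior Θ) :
    HasFDerivAt (gradient ψ) (hess ψ θ) θ :=
  ((h.contDiffAt_gradient hθ).differentiableAt (by norm_num)).hasFDerivAt

theorem monotone (h : IsMirror Θ ψ α) (hθ : θ ∈ interior Θ) (hθ' : θ' ∈ interior Θ) :
    α * ‖θ - θ'‖ ^ 2 ≤ ⟪gradient ψ θ - gradient ψ θ', θ - θ'⟫_ℝ :=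
  mul_sq_le_inner_gradient_sub h.strongConvex hθ hθ' (h.differentiableAt hθ)
    (h.differentiableAt hθ')

theorem expand (h : IsMirror Θ ψ α) (hθ : θ ∈ interior Θ) (hθ' : θ' ∈ interior Θ) :
    α * ‖θ - θ'‖ ≤ ‖gradient ψ θ - gradient ψ θ'‖ :=
  mul_norm_le_of_mul_sq_le_inner (h.monotone hθ hθ')

theorem coercive_hess (h : IsMirror Θ ψ α) (hθ : θ ∈ interior Θ)
    (v : EuclideanSpace ℝ (Fin d)) : α * ‖v‖ ^ 2 ≤ ⟪hess ψ θ v, v⟫_ℝ :=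
  mul_sq_le_inner_of_hasFDerivAt (isOpen_interior.mem_nhds hθ)
    (fun _ hy => h.monotone hy hθ) (h.hasFDerivAt_gradient hθ) v

theorem exists_equiv_hess (h : IsMirror Θ ψ α) (hθ : θ ∈ interior Θ) :
    ∃ e : EuclideanSpace ℝ (Fin d) ≃L[ℝ] EuclideanSpace ℝ (Fin d),
      (e : EuclideanSpace ℝ (Fin d) →L[ℝ] EuclideanSpace ℝ (Fin d)) = hess ψ θ ∧
      (e.symm : EuclideanSpace ℝ (Fin d) →L[ℝ] EuclideanSpace ℝ (Fin d)) = invHess ψ θ := by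
  obtain ⟨e, he⟩ := exists_equiv_of_coercive h.pos (h.coercive_hess hθ)
  exact ⟨e, he, by rw [invHess, ← he, ContinuousLinearMap.inverse_equiv]⟩

theorem norm_invHess_le (h : IsMirror Θ ψ α) (hθ : θ ∈ interior Θ) : ‖invHess ψ θ‖ ≤ α⁻¹ :=
  norm_inverse_le_of_coercive h.pos (h.coercive_hess hθ)

/-- Symmetry of the second derivative of a C² function, carried to the gradient by the Riesz
isomorphism. -/
theorem inner_hess_comm (h : IsMirror Θ ψ α) (hθ : θ ∈ interior Θ)
    (v w : EuclideanSpace ℝ (Fin d)) : ⟪hess ψ θ v, w⟫_ℝ = ⟪hess ψ θ w, v⟫_ℝ := by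
  have hs := (h.contDiffAt hθ).isSymmSndFDerivAt (by simp)
  have h1 : DifferentiableAt ℝ (fderiv ℝ ψ) θ :=
    ((h.contDiffAt hθ).fderiv_right (m := 1) (by norm_num)).differentiableAt (by norm_num)
  have key : ∀ v w, ⟪hess ψ θ v, w⟫_ℝ = fderiv ℝ (fderiv ℝ ψ) θ v w := by
    intro v w
    have h2 : HasFDerivAt (gradient ψ)
        (((InnerProductSpace.toDual ℝ
          (EuclideanSpace ℝ (Fin d))).symm.toContinuousLinearEquiv.toContinuousLinearMap).comp
          (fderiv ℝ (fderiv ℝ ψ) θ)) θ :=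
      ((InnerProductSpace.toDual ℝ
        (EuclideanSpace ℝ (Fin d))).symm.toContinuousLinearEquiv.toContinuousLinearMap
          |>.hasFDerivAt).comp θ h1.hasFDerivAt
    rw [hess, h2.fderiv]
    exact InnerProductSpace.toDual_symm_apply
  rw [key, key, hs.eq]

theorem inner_invHess_comm (h : IsMirror Θ ψ α) (hθ : θ ∈ interior Θ)
    (v w : EuclideanSpace ℝ (Fin d)) : ⟪invHess ψ θ v, w⟫_ℝ = ⟪v, invHess ψ θ w⟫_ℝ := by
  obtain ⟨e, he, he'⟩ := h.exists_equiv_hess hθ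
  have := h.inner_hess_comm hθ (invHess ψ θ w) (invHess ψ θ v)
  rw [← he, ← he'] at this
  simp only [ContinuousLinearEquiv.coe_coe, ContinuousLinearEquiv.apply_symm_apply] at this
  rw [← he']
  simp only [ContinuousLinearEquiv.coe_coe]
  rw [← this, real_inner_comm]

theorem adjoint_invHess (h : IsMirror Θ ψ α) (hθ : θ ∈ interior Θ) :
    ContinuousLinearMap.adjoint (invHess ψ θ) = invHess ψ θ := by
  symm
  rw [ContinuousLinearMap.eq_adjoint_iff]
  exact h.inner_invHess_comm hθ

/-- The map ∇ψ expands distances by at least α, so preimages of a convergent sequence are Cauchy,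
with a limit in the closed set Θ. Essential smoothness rules out a limit on the boundary, where the
norms of ∇ψ would diverge. -/
theorem isClosed_image_gradient (h : IsMirror Θ ψ α) : IsClosed (gradient ψ '' interior Θ) := by
  refine isSeqClosed_iff_isClosed.1 ?_
  intro u η hu hlim
  choose θ hθ hθu using hu
  have hc : CauchySeq θ := by
    have hcu := hlim.cauchySeq
    rw [Metric.cauchySeq_iff] at hcu ⊢
    intro ε hε
    obtain ⟨N, hN⟩ := hcu (α * ε) (mul_pos h.pos hε)
    refine ⟨N, fun m hm n hn => ?_⟩
    have h1 := hN m hm n hn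
    have h2 := h.expand (hθ m) (hθ n)
    rw [dist_eq_norm] at h1 ⊢
    rw [hθu, hθu] at h2
    exact lt_of_mul_lt_mul_left (h2.trans_lt h1) h.pos.le
  obtain ⟨θ₀, hθ₀⟩ := cauchySeq_tendsto_of_complete hc
  have hmem : θ₀ ∈ Θ :=
    h.closed.mem_of_tendsto hθ₀ (Eventually.of_forall fun n => interior_subset (hθ n))
  by_cases hin : θ₀ ∈ interior Θ
  · refine ⟨θ₀, hin, ?_⟩
    have := ((h.contDiffAt_gradient hin).continuousAt.tendsto.comp hθ₀)
    refine tendsto_nhds_unique this (hlim.congr fun n => ?_)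
    exact (hθu n).symm
  · have hfr : θ₀ ∈ frontier Θ := ⟨subset_closure hmem, hin⟩
    have h1 := (h.smooth.2 θ₀ hfr).comp
      (tendsto_nhdsWithin_iff.2 ⟨hθ₀, Eventually.of_forall hθ⟩)
    have h2 : Tendsto (fun n => ‖u n‖) atTop (𝓝 ‖η‖) := hlim.norm
    refine absurd ?_ (not_tendsto_nhds_of_tendsto_atTop h1 ‖η‖)
    refine h2.congr fun n => ?_
    simp [hθu]

/-- The inverse function theorem, the Hessian being invertible by coercivity. -/
theorem isOpen_image_gradient (h : IsMirror Θ ψ α) : IsOpen (gradient ψ '' interior Θ) := by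
  rw [isOpen_iff_mem_nhds]
  rintro _ ⟨θ, hθ, rfl⟩
  obtain ⟨e, he, -⟩ := h.exists_equiv_hess hθ
  have h1 : HasStrictFDerivAt (gradient ψ)
      (e : EuclideanSpace ℝ (Fin d) →L[ℝ] EuclideanSpace ℝ (Fin d)) θ := by
    rw [he]
    exact (h.contDiffAt_gradient hθ).hasStrictFDerivAt (by norm_num)
  rw [← h1.map_nhds_eq_of_equiv]
  exact image_mem_map (isOpen_interior.mem_nhds hθ)

theorem image_gradient (h : IsMirror Θ ψ α) : gradient ψ '' interior Θ = univ :=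
  IsClopen.eq_univ ⟨h.isClosed_image_gradient, h.isOpen_image_gradient⟩ (h.nonempty.image _)

theorem conjugate_gradient (h : IsMirror Θ ψ α) (hθ : θ ∈ interior Θ) :
    conjugate Θ ψ (gradient ψ θ) = ⟪gradient ψ θ, θ⟫_ℝ - ψ θ := by
  refine IsGreatest.csSup_eq ⟨⟨θ, hθ, rfl⟩, ?_⟩
  rintro _ ⟨x, hx, rfl⟩
  have h1 := add_inner_gradient_le_of_strongConvexOn h.strongConvex hθ hx (h.differentiableAt hθ)
  rw [inner_sub_right] at h1
  have : 0 ≤ α / 2 * ‖x - θ‖ ^ 2 := by have := h.pos; positivity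
  simp only
  linarith

/-- A right inverse of `∇ψ` with values in the interior of `Θ` is differentiable. -/
theorem hasFDerivAt_rightInverse (h : IsMirror Θ ψ α)
    {T : EuclideanSpace ℝ (Fin d) → EuclideanSpace ℝ (Fin d)} (hT : ∀ η, T η ∈ interior Θ)
    (hT' : ∀ η, gradient ψ (T η) = η) (η : EuclideanSpace ℝ (Fin d)) :
    HasFDerivAt T (invHess ψ (T η)) η := by
  obtain ⟨e, he, he'⟩ := h.exists_equiv_hess (hT η)
  -- Expansion of ∇ψ by α makes any right inverse α⁻¹-Lipschitz, and continuity is what the inverse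
  -- derivative rule asks for.
  have hcont : Continuous T := by
    have : LipschitzWith (Real.toNNReal α⁻¹) T := by
      refine LipschitzWith.of_dist_le_mul fun x y => ?_
      have := h.expand (hT x) (hT y)
      rw [hT', hT'] at this
      rw [dist_eq_norm, dist_eq_norm, Real.coe_toNNReal _ (inv_nonneg.2 h.pos.le)]
      rwa [le_inv_mul_iff₀ h.pos]
    exact this.continuous
  have h1 : HasFDerivAt (gradient ψ)
      (e : EuclideanSpace ℝ (Fin d) →L[ℝ] EuclideanSpace ℝ (Fin d)) (T η) := by
    rw [he]
    exact h.hasFDerivAt_gradient (hT η)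
  rw [← he']
  exact HasFDerivAt.of_local_left_inverse hcont.continuousAt h1 (Eventually.of_forall hT')

/-- The supremum defining ψ* is attained at T η, so ψ*(η) = ⟪η, T η⟫ - ψ(T η). On differentiating,
the two terms containing DT cancel because ∇ψ(T η) = η, and T η remains. -/
theorem gradient_conjugate_of_rightInverse (h : IsMirror Θ ψ α)
    {T : EuclideanSpace ℝ (Fin d) → EuclideanSpace ℝ (Fin d)} (hT : ∀ η, T η ∈ interior Θ)
    (hT' : ∀ η, gradient ψ (T η) = η) (η : EuclideanSpace ℝ (Fin d)) :
    gradient (conjugate Θ ψ) η = T η := by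
  have hd := h.hasFDerivAt_rightInverse hT hT' η
  have hconj : conjugate Θ ψ = fun η => ⟪η, T η⟫_ℝ - ψ (T η) := by
    ext η
    have := h.conjugate_gradient (hT η)
    rwa [hT'] at this
  have h1 := ((hasFDerivAt_id η).inner ℝ hd).sub
    ((h.differentiableAt (hT η)).hasFDerivAt.comp η hd)
  refine HasGradientAt.gradient (hasGradientAt_iff_hasFDerivAt.2 ?_)
  rw [hconj]
  refine h1.congr_fderiv ?_
  ext v
  have := inner_gradient_left (𝕜 := ℝ) (f := ψ) (x := T η) (y := invHess ψ (T η) v)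
  rw [hT'] at this
  simp [this, real_inner_comm]

theorem exists_rightInverse (h : IsMirror Θ ψ α) :
    ∃ T : EuclideanSpace ℝ (Fin d) → EuclideanSpace ℝ (Fin d),
      (∀ η, T η ∈ interior Θ) ∧ ∀ η, gradient ψ (T η) = η := by
  have : ∀ η, ∃ θ ∈ interior Θ, gradient ψ θ = η := fun η => by
    have := mem_univ η
    rwa [← h.image_gradient] at this
  choose T hT hT' using this
  exact ⟨T, hT, hT'⟩

theorem gradient_conjugate_mem (h : IsMirror Θ ψ α) (η : EuclideanSpace ℝ (Fin d)) :
    gradient (conjugate Θ ψ) η ∈ interior Θ := by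
  obtain ⟨T, hT, hT'⟩ := h.exists_rightInverse
  rw [h.gradient_conjugate_of_rightInverse hT hT']
  exact hT η

theorem gradient_gradient_conjugate (h : IsMirror Θ ψ α) (η : EuclideanSpace ℝ (Fin d)) :
    gradient ψ (gradient (conjugate Θ ψ) η) = η := by
  obtain ⟨T, hT, hT'⟩ := h.exists_rightInverse
  rw [h.gradient_conjugate_of_rightInverse hT hT']
  exact hT' η

theorem gradient_conjugate_gradient (h : IsMirror Θ ψ α) (hθ : θ ∈ interior Θ) :
    gradient (conjugate Θ ψ) (gradient ψ θ) = θ := by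
  have h1 := h.expand (h.gradient_conjugate_mem (gradient ψ θ)) hθ
  rw [h.gradient_gradient_conjugate, sub_self, norm_zero] at h1
  have h2 := h.pos
  exact sub_eq_zero.1 (norm_le_zero_iff.1
    (nonpos_of_mul_nonpos_right h1 h2))

theorem hasFDerivAt_gradient_conjugate (h : IsMirror Θ ψ α) (η : EuclideanSpace ℝ (Fin d)) :
    HasFDerivAt (gradient (conjugate Θ ψ)) (invHess ψ (gradient (conjugate Θ ψ) η)) η :=
  h.hasFDerivAt_rightInverse h.gradient_conjugate_mem h.gradient_gradient_conjugate η

theorem continuous_gradient_conjugate (h : IsMirror Θ ψ α) :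
    Continuous (gradient (conjugate Θ ψ)) :=
  continuous_iff_continuousAt.2 fun η => (h.hasFDerivAt_gradient_conjugate η).continuousAt

theorem hess_conjugate (h : IsMirror Θ ψ α) (η : EuclideanSpace ℝ (Fin d)) :
    hess (conjugate Θ ψ) η = invHess ψ (gradient (conjugate Θ ψ) η) :=
  (h.hasFDerivAt_gradient_conjugate η).fderiv

end IsMirror

end

section

/-! ### Derivatives of determinants. -/

section Det

variable {E : Type*} [NormedAddCommGroup E] [NormedSpace ℝ E] [FiniteDimensional ℝ E]

/-- The trace of a continuous linear endomorphism. -/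
def opTrace (F : E →L[ℝ] E) : ℝ := LinearMap.trace ℝ E (F : E →ₗ[ℝ] E)

theorem contDiff_det : ContDiff ℝ 1 fun A : E →L[ℝ] E => A.det := by
  let b := Module.finBasis ℝ E
  have h : (fun A : E →L[ℝ] E => A.det) = fun A : E →L[ℝ] E =>
      ∑ σ : Equiv.Perm (Fin (Module.finrank ℝ E)),
        ((Equiv.Perm.sign σ : ℤ) : ℝ) * ∏ i, b.repr (A (b i)) (σ i) := by
    ext A
    rw [ContinuousLinearMap.det, ← LinearMap.det_toMatrix b, Matrix.det_apply']
    simp [LinearMap.toMatrix_apply]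
  rw [h]
  refine ContDiff.sum fun σ _ => contDiff_const.mul (contDiff_prod fun i _ => ?_)
  have h2 : IsLinearMap ℝ fun A : E →L[ℝ] E => b.repr (A (b i)) (σ i) :=
    ⟨fun A B => by simp, fun c A => by simp⟩
  exact (LinearMap.toContinuousLinearMap h2.mk').contDiff

/-- Jacobi's formula at the identity. -/
theorem hasDerivAt_det_one_add_smul (M : E →L[ℝ] E) :
    HasDerivAt (fun t : ℝ => (1 + t • M).det) (opTrace M) 0 := by
  let b := Module.finBasis ℝ E
  let N := LinearMap.toMatrix b b (M : E →ₗ[ℝ] E)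
  -- The polynomial det(1 + X N) without its constant and linear terms, divided by X²: it
  -- contributes nothing to the derivative at 0.
  let P := (1 + (Polynomial.X : Polynomial ℝ) • N.map Polynomial.C).det.divX.divX
  have h : (fun t : ℝ => (1 + t • M).det) = fun t => 1 + N.trace * t + P.eval t * t ^ 2 := by
    ext t
    rw [ContinuousLinearMap.det, ← LinearMap.det_toMatrix b, ← Matrix.det_one_add_smul]
    congr 1
    simp [N, LinearMap.toMatrix_one]
  rw [h, opTrace, LinearMap.trace_eq_matrix_trace ℝ b]
  have h1 : HasDerivAt (fun t : ℝ => 1 + N.trace * t) (N.trace) 0 := by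
    simpa using ((hasDerivAt_id (0 : ℝ)).const_mul N.trace).const_add 1
  have h2 := (P.hasDerivAt 0).mul ((hasDerivAt_id (0 : ℝ)).pow 2)
  refine (h1.add h2).congr_deriv ?_
  simp [N]

/-- Jacobi's formula for the logarithm of the determinant. -/
theorem hasFDerivAt_log_det {X : Type*} [NormedAddCommGroup X] [NormedSpace ℝ X]
    {A : X → E →L[ℝ] E} {A' : X →L[ℝ] E →L[ℝ] E} {x : X} (hA : HasFDerivAt A A' x)
    (e : E ≃L[ℝ] E) (he : (e : E →L[ℝ] E) = A x) :
    ∃ D : X →L[ℝ] ℝ, HasFDerivAt (fun y => Real.log (A y).det) D x ∧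
      ∀ w, D w = opTrace ((e.symm : E →L[ℝ] E) ∘L A' w) := by
  have hdet : (A x).det ≠ 0 := by
    rw [← he]
    exact (LinearEquiv.isUnit_det' e.toLinearEquiv).ne_zero
  have h1 := (contDiff_det (E := E)).differentiable (by norm_num) (A x)
  have h2 : ∀ Y : E →L[ℝ] E, fderiv ℝ (fun A : E →L[ℝ] E => A.det) (A x) Y
      = (A x).det * opTrace ((e.symm : E →L[ℝ] E) ∘L Y) := by
    intro Y
    have h3 : HasDerivAt (fun t : ℝ => A x + t • Y) Y 0 := by
      simpa using ((hasDerivAt_id (0 : ℝ)).smul_const Y).const_add (A x)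
    have h4 : HasFDerivAt (fun A : E →L[ℝ] E => A.det)
        (fderiv ℝ (fun A : E →L[ℝ] E => A.det) (A x)) (A x + (0 : ℝ) • Y) := by
      simpa using h1.hasFDerivAt
    have h5 := h4.comp_hasDerivAt (0 : ℝ) h3
    -- Factor A + tY = A (1 + t A⁻¹Y) and use multiplicativity of the determinant.
    have h6 := (hasDerivAt_det_one_add_smul ((e.symm : E →L[ℝ] E) ∘L Y)).const_mul (A x).det
    refine h5.unique (h6.congr_of_eventuallyEq (Eventually.of_forall fun t => ?_))
    simp only [Function.comp_def]
    rw [ContinuousLinearMap.det, ContinuousLinearMap.det, ContinuousLinearMap.det,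
      ← LinearMap.det_comp]
    congr 1
    ext v
    simp [← he]
  refine ⟨_, (h1.hasFDerivAt.comp x hA).log hdet, fun w => ?_⟩
  simp [h2, hdet]

end Det

/-! ### The score of the mirrored density and the Stein operator. -/

variable {d : ℕ} {Θ : Set (EuclideanSpace ℝ (Fin d))} {p ψ : EuclideanSpace ℝ (Fin d) → ℝ} {α : ℝ}

theorem trace_eq_sum_stdVec (F : EuclideanSpace ℝ (Fin d) →L[ℝ] EuclideanSpace ℝ (Fin d)) :
    opTrace F = ∑ i, F (stdVec i) i := by
  rw [opTrace, LinearMap.trace_eq_matrix_trace ℝ (EuclideanSpace.basisFun (Fin d) ℝ).toBasis,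
    Matrix.trace]
  simp [LinearMap.toMatrix_apply, stdVec]

namespace IsMirror

theorem det_invHess_ne_zero (h : IsMirror Θ ψ α) {θ : EuclideanSpace ℝ (Fin d)}
    (hθ : θ ∈ interior Θ) : (invHess ψ θ).det ≠ 0 := by
  obtain ⟨e, -, he⟩ := h.exists_equiv_hess hθ
  rw [← he]
  exact (LinearEquiv.isUnit_det' e.symm.toLinearEquiv).ne_zero

theorem mirroredDensity_eq (h : IsMirror Θ ψ α) (η : EuclideanSpace ℝ (Fin d)) :
    mirroredDensity Θ p ψ η = p (gradient (conjugate Θ ψ) η) *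
      |(invHess ψ (gradient (conjugate Θ ψ) η)).det| := by
  rw [mirroredDensity, h.hess_conjugate]

theorem mirroredDensity_pos (h : IsMirror Θ ψ α) (hp : ∀ θ ∈ interior Θ, 0 < p θ)
    (η : EuclideanSpace ℝ (Fin d)) : 0 < mirroredDensity Θ p ψ η := by
  rw [h.mirroredDensity_eq]
  exact mul_pos (hp _ (h.gradient_conjugate_mem η))
    (abs_pos.2 (h.det_invHess_ne_zero (h.gradient_conjugate_mem η)))

/-- The trace from Jacobi's formula is put in the form in which it occurs in the divergence of x ↦
∇²ψ(x)⁻¹ g(x), so that the two can be matched in `steinOp_eq`. -/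
theorem exists_hasFDerivAt_log_mirroredDensity (h : IsMirror Θ ψ α)
    (hp : ∀ θ ∈ interior Θ, 0 < p θ) (hpd : DifferentiableOn ℝ p (interior Θ))
    (hA : DifferentiableOn ℝ (invHess ψ) (interior Θ)) (η : EuclideanSpace ℝ (Fin d)) :
    ∃ D : EuclideanSpace ℝ (Fin d) →L[ℝ] ℝ,
      HasFDerivAt (fun η => Real.log (mirroredDensity Θ p ψ η)) D η ∧
      ∀ w, D w =
        fderiv ℝ (fun x => Real.log (p x)) (gradient (conjugate Θ ψ) η)
          (invHess ψ (gradient (conjugate Θ ψ) η) w) +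
        opTrace ((fderiv ℝ (invHess ψ) (gradient (conjugate Θ ψ) η)).flip w) := by
  set T := gradient (conjugate Θ ψ) with hT
  have hθ := h.gradient_conjugate_mem η
  have hU := isOpen_interior.mem_nhds hθ
  have hdT := h.hasFDerivAt_gradient_conjugate η
  obtain ⟨e, -, he'⟩ := h.exists_equiv_hess hθ
  have hlogp : DifferentiableAt ℝ (fun x => Real.log (p x)) (T η) :=
    ((hpd _ hθ).differentiableAt hU).log (hp _ hθ).ne'
  have hAd := ((hA _ hθ).differentiableAt hU).hasFDerivAt
  have hAT : HasFDerivAt (fun y => invHess ψ (T y))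
      ((fderiv ℝ (invHess ψ) (T η)).comp (invHess ψ (T η))) η := hAd.comp η hdT
  obtain ⟨D, hD, hDw⟩ := hasFDerivAt_log_det hAT e.symm he'
  refine ⟨_, ((hlogp.hasFDerivAt.comp η hdT).add hD).congr_of_eventuallyEq
    (Eventually.of_forall fun y => ?_), fun w => ?_⟩
  · have hy := h.gradient_conjugate_mem y
    simp only [Function.comp_apply, Pi.add_apply]
    rw [h.mirroredDensity_eq, Real.log_mul (hp _ hy).ne'
      (abs_ne_zero.2 (h.det_invHess_ne_zero hy)), Real.log_abs]
  -- Symmetry of the second derivative of ∇ψ*. It rewrites the matrix in Jacobi's formula as a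
  -- conjugate, by ∇²ψ⁻¹, of the matrix wanted, and conjugation preserves the trace.
  · have hsymm : ∀ v w, (fderiv ℝ (invHess ψ) (T η)) (invHess ψ (T η) v) w
        = (fderiv ℝ (invHess ψ) (T η)) (invHess ψ (T η) w) v := fun v w =>
      second_derivative_symmetric h.hasFDerivAt_gradient_conjugate hAT v w
    rw [_root_.add_apply, hDw]
    congr 1
    rw [opTrace, opTrace, ← LinearMap.trace_conj' (((fderiv ℝ (invHess ψ) (T η)).flip w :
      EuclideanSpace ℝ (Fin d) →ₗ[ℝ] EuclideanSpace ℝ (Fin d))) e.toLinearEquiv]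
    congr 1
    ext v : 1
    have : invHess ψ (T η) v = e.symm v := by rw [← he']; rfl
    simp only [LinearEquiv.conj_apply]
    simp [hsymm w, this]

theorem hasGradientAt_log_mirroredDensity (h : IsMirror Θ ψ α)
    (hp : ∀ θ ∈ interior Θ, 0 < p θ) (hpd : DifferentiableOn ℝ p (interior Θ))
    (hA : DifferentiableOn ℝ (invHess ψ) (interior Θ)) (η : EuclideanSpace ℝ (Fin d)) :
    HasGradientAt (fun η => Real.log (mirroredDensity Θ p ψ η))
      (gradient (fun η => Real.log (mirroredDensity Θ p ψ η)) η) η := by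
  obtain ⟨D, hD, -⟩ := h.exists_hasFDerivAt_log_mirroredDensity hp hpd hA η
  exact hD.differentiableAt.hasGradientAt

/-- In the mirrored coordinates `η = ∇ψ(θ)` the mirrored Stein operator is the usual Stein operator
of the mirrored density. -/
theorem steinOp_eq (h : IsMirror Θ ψ α)
    (hp : ∀ θ ∈ interior Θ, 0 < p θ) (hpd : DifferentiableOn ℝ p (interior Θ))
    (hA : DifferentiableOn ℝ (invHess ψ) (interior Θ))
    {g : EuclideanSpace ℝ (Fin d) → EuclideanSpace ℝ (Fin d)} (η : EuclideanSpace ℝ (Fin d))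
    (hg : DifferentiableAt ℝ g (gradient (conjugate Θ ψ) η)) :
    steinOp p ψ g (gradient (conjugate Θ ψ) η) =
      ⟪gradient (fun η => Real.log (mirroredDensity Θ p ψ η)) η,
        g (gradient (conjugate Θ ψ) η)⟫_ℝ +
      opTrace (fderiv ℝ g (gradient (conjugate Θ ψ) η) ∘L
        invHess ψ (gradient (conjugate Θ ψ) η)) := by
  obtain ⟨D, hD, hDw⟩ := h.exists_hasFDerivAt_log_mirroredDensity hp hpd hA η
  set θ := gradient (conjugate Θ ψ) η
  have hθ : θ ∈ interior Θ := h.gradient_conjugate_mem η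
  have hAd := ((hA _ hθ).differentiableAt (isOpen_interior.mem_nhds hθ)).hasFDerivAt
  have hdiv : divergence (fun x => invHess ψ x (g x)) θ =
      opTrace ((fderiv ℝ (invHess ψ) θ).flip (g θ)) + opTrace (fderiv ℝ g θ ∘L invHess ψ θ) := by
    have hc : opTrace (fderiv ℝ g θ ∘L invHess ψ θ) = opTrace (invHess ψ θ ∘L fderiv ℝ g θ) :=
      LinearMap.trace_mul_comm ℝ (fderiv ℝ g θ : EuclideanSpace ℝ (Fin d) →ₗ[ℝ] _)
        (invHess ψ θ : EuclideanSpace ℝ (Fin d) →ₗ[ℝ] _)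
    rw [hc, trace_eq_sum_stdVec, trace_eq_sum_stdVec, ← Finset.sum_add_distrib, divergence]
    refine Finset.sum_congr rfl fun i _ => ?_
    rw [(hAd.clm_apply hg.hasFDerivAt).fderiv]
    simp [add_comm]
  rw [steinOp, hdiv, inner_gradient_left, hD.fderiv, hDw, ← h.inner_invHess_comm hθ,
    real_inner_comm, inner_gradient_left, add_assoc]

end IsMirror

end

section

/-! ### Differentiability of Hilbert space valued maps from inner products. -/

section Increments

variable {X H : Type*} [NormedAddCommGroup X] [NormedSpace ℝ X] [NormedAddCommGroup H]
  [InnerProductSpace ℝ H]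

theorem norm_sub_sub_sq (a b c : H) : ‖a - b - c‖ ^ 2 =
    ⟪a, a⟫_ℝ + ⟪b, b⟫_ℝ + ⟪c, c⟫_ℝ - 2 * ⟪a, b⟫_ℝ - 2 * ⟪a, c⟫_ℝ + 2 * ⟪b, c⟫_ℝ := by
  rw [← real_inner_self_eq_norm_sq]
  simp only [inner_sub_left, inner_sub_right]
  rw [real_inner_comm a b, real_inner_comm a c, real_inner_comm b c]
  ring

/-- A map into a Hilbert space is differentiable at `x` as soon as the inner products of its
increments at `x` are approximated by a bounded bilinear form. -/
theorem exists_hasFDerivAt_of_inner_increments [CompleteSpace H] {Φ : X → H} {x : X}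
    {B : X →L[ℝ] X →L[ℝ] ℝ}
    (hB : ∀ ε > 0, ∃ δ > 0, ∀ h k, ‖h‖ < δ → ‖k‖ < δ →
      |⟪Φ (x + h) - Φ x, Φ (x + k) - Φ x⟫_ℝ - B h k| ≤ ε * (‖h‖ * ‖k‖)) :
    ∃ D : X →L[ℝ] H, HasFDerivAt Φ D x ∧ ∀ h k, ⟪D h, D k⟫_ℝ = B h k := by
  -- Difference quotients along steps 1/(n+1). Their mutual inner products converge to B, which
  -- makes them Cauchy and determines the inner products of their limits.
  let Q : ℕ → X → H := fun n h => ((n : ℝ) + 1) • (Φ (x + ((n : ℝ) + 1)⁻¹ • h) - Φ x)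
  have hpos : ∀ n : ℕ, (0 : ℝ) < (n : ℝ) + 1 := fun n => n.cast_add_one_pos
  have hsmall : ∀ (h : X) (δ : ℝ), 0 < δ → ∃ N : ℕ, ∀ n ≥ N, ‖((n : ℝ) + 1)⁻¹ • h‖ < δ := by
    intro h δ hδ
    have h1 : Tendsto (fun n : ℕ => ((n : ℝ) + 1)⁻¹ • h) atTop (𝓝 ((0 : ℝ) • h)) := by
      refine Tendsto.smul_const ?_ h
      simpa [one_div] using tendsto_one_div_add_atTop_nhds_zero_nat (𝕜 := ℝ)
    rw [zero_smul] at h1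
    have h2 := h1.norm
    rw [norm_zero] at h2
    exact eventually_atTop.1 (h2.eventually_lt_const hδ)
  have hS : ∀ h k, ∀ ε > 0, ∃ N : ℕ, ∀ m ≥ N, ∀ n ≥ N, |⟪Q m h, Q n k⟫_ℝ - B h k| ≤ ε := by
    intro h k ε hε
    obtain ⟨δ, hδ, hδB⟩ := hB (ε / (‖h‖ * ‖k‖ + 1)) (by positivity)
    obtain ⟨N₁, hN₁⟩ := hsmall h δ hδ
    obtain ⟨N₂, hN₂⟩ := hsmall k δ hδ
    refine ⟨max N₁ N₂, fun m hm n hn => ?_⟩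
    have h1 := hδB _ _ (hN₁ m (le_trans (le_max_left _ _) hm))
      (hN₂ n (le_trans (le_max_right _ _) hn))
    have e : ⟪Q m h, Q n k⟫_ℝ - B h k = (((m : ℝ) + 1) * ((n : ℝ) + 1)) *
        (⟪Φ (x + ((m : ℝ) + 1)⁻¹ • h) - Φ x, Φ (x + ((n : ℝ) + 1)⁻¹ • k) - Φ x⟫_ℝ
          - B (((m : ℝ) + 1)⁻¹ • h) (((n : ℝ) + 1)⁻¹ • k)) := by
      have := (hpos m).ne'
      have := (hpos n).ne'
      simp only [Q, real_inner_smul_left, real_inner_smul_right, map_smul, smul_apply, smul_eq_mul]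
      field_simp
    rw [e, abs_mul, abs_of_pos (mul_pos (hpos m) (hpos n))]
    calc _ ≤ _ := mul_le_mul_of_nonneg_left h1 (mul_pos (hpos m) (hpos n)).le
      _ = ε * ((‖h‖ * ‖k‖) / (‖h‖ * ‖k‖ + 1)) := by
        have := (hpos m).ne'
        have := (hpos n).ne'
        rw [norm_smul, norm_smul, norm_inv, norm_inv, Real.norm_of_nonneg (hpos m).le,
          Real.norm_of_nonneg (hpos n).le]
        field_simp
      _ ≤ ε * 1 := by
        refine mul_le_mul_of_nonneg_left ?_ hε.le
        rw [div_le_one (by positivity)]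
        linarith
      _ = ε := mul_one ε
  have hlim : ∀ h, ∃ l, Tendsto (fun n => Q n h) atTop (𝓝 l) := by
    intro h
    refine cauchySeq_tendsto_of_complete ?_
    rw [Metric.cauchySeq_iff]
    intro ε hε
    -- Expanding ‖Q m h - Q n h‖², the errors add up with weights 1 + 2 + 1 and the B h h terms
    -- cancel: at most 4ε²/5 is left.
    obtain ⟨N, hN⟩ := hS h h (ε ^ 2 / 5) (by positivity)
    refine ⟨N, fun m hm n hn => ?_⟩
    rw [dist_eq_norm]
    refine lt_of_pow_lt_pow_left₀ 2 hε.le ?_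
    have h1 := abs_le.1 (hN m hm m hm)
    have h2 := abs_le.1 (hN m hm n hn)
    have h3 := abs_le.1 (hN n hn n hn)
    rw [norm_sub_sq_real, ← real_inner_self_eq_norm_sq, ← real_inner_self_eq_norm_sq]
    have : 0 < ε ^ 2 := by positivity
    linarith [h1.2, h2.1, h3.2]
  choose D₀ hD₀ using hlim
  have hinner : ∀ h k, ⟪D₀ h, D₀ k⟫_ℝ = B h k := by
    intro h k
    refine tendsto_nhds_unique ((hD₀ h).inner (hD₀ k)) (Metric.tendsto_atTop.2 fun ε hε => ?_)
    obtain ⟨N, hN⟩ := hS h k (ε / 2) (by positivity)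
    refine ⟨N, fun n hn => ?_⟩
    rw [Real.dist_eq]
    exact (hN n hn n hn).trans_lt (by linarith)
  -- Linearity of the limit: the squared norm of the defect expands into values of the bilinear form
  -- B, and these cancel.
  have hadd : ∀ h k, D₀ (h + k) = D₀ h + D₀ k := by
    intro h k
    rw [← sub_eq_zero, ← sub_sub, ← norm_eq_zero, ← sq_eq_zero_iff, norm_sub_sub_sq]
    simp only [hinner, map_add, add_apply]
    rw [← hinner k h, real_inner_comm, hinner]
    ring
  have hsmul : ∀ (c : ℝ) h, D₀ (c • h) = c • D₀ h := by
    intro c h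
    rw [← sub_eq_zero, ← norm_eq_zero, ← sq_eq_zero_iff, norm_sub_sq_real,
      ← real_inner_self_eq_norm_sq, ← real_inner_self_eq_norm_sq]
    simp only [real_inner_smul_left, real_inner_smul_right, hinner, map_smul, smul_apply,
      smul_eq_mul]
    ring
  let D₁ : X →ₗ[ℝ] H := { toFun := D₀, map_add' := hadd, map_smul' := hsmul }
  let D : X →L[ℝ] H := D₁.mkContinuous (√‖B‖) fun h => by
    refine (sq_le_sq₀ (by positivity) (by positivity)).1 ?_
    rw [mul_pow, Real.sq_sqrt (norm_nonneg B), ← real_inner_self_eq_norm_sq]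
    calc ⟪D₀ h, D₀ h⟫_ℝ = B h h := hinner h h
      _ ≤ ‖B h h‖ := le_abs_self _
      _ ≤ ‖B‖ * ‖h‖ * ‖h‖ := B.le_opNorm₂ h h
      _ = ‖B‖ * ‖h‖ ^ 2 := by ring
  refine ⟨D, ?_, hinner⟩
  rw [hasFDerivAt_iff_isLittleO_nhds_zero, Asymptotics.isLittleO_iff]
  intro c hc
  -- The squared remainder has one error from the increment with itself and twice one from the
  -- increment with D h, hence the factor 1/3.
  obtain ⟨δ, hδ, hδB⟩ := hB (c ^ 2 / 3) (by positivity)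
  filter_upwards [Metric.ball_mem_nhds (0 : X) hδ] with h hh
  rw [mem_ball_zero_iff] at hh
  have h1 := abs_le.1 (hδB h h hh hh)
  have h2 : |⟪Φ (x + h) - Φ x, D₀ h⟫_ℝ - B h h| ≤ c ^ 2 / 3 * (‖h‖ * ‖h‖) := by
    have ht : Tendsto (fun n => |⟪Φ (x + h) - Φ x, Q n h⟫_ℝ - B h h|) atTop
        (𝓝 |⟪Φ (x + h) - Φ x, D₀ h⟫_ℝ - B h h|) :=
      ((tendsto_const_nhds.inner (hD₀ h)).sub_const _).abs
    refine le_of_tendsto' ht fun n => ?_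
    have hn : ‖((n : ℝ) + 1)⁻¹ • h‖ < δ := by
      rw [norm_smul, norm_inv, Real.norm_of_nonneg (hpos n).le]
      refine lt_of_le_of_lt ?_ hh
      refine mul_le_of_le_one_left (norm_nonneg _) (inv_le_one_of_one_le₀ ?_)
      linarith [n.cast_nonneg (α := ℝ)]
    have h3 := hδB h _ hh hn
    have e : ⟪Φ (x + h) - Φ x, Q n h⟫_ℝ - B h h = ((n : ℝ) + 1) *
        (⟪Φ (x + h) - Φ x, Φ (x + ((n : ℝ) + 1)⁻¹ • h) - Φ x⟫_ℝ
          - B h (((n : ℝ) + 1)⁻¹ • h)) := by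
      have := (hpos n).ne'
      simp only [Q, real_inner_smul_right, map_smul, smul_eq_mul]
      field_simp
    rw [e, abs_mul, abs_of_pos (hpos n)]
    refine (mul_le_mul_of_nonneg_left h3 (hpos n).le).trans (le_of_eq ?_)
    have := (hpos n).ne'
    rw [norm_smul, norm_inv, Real.norm_of_nonneg (hpos n).le]
    field_simp
  have h2' := abs_le.1 h2
  refine (sq_le_sq₀ (norm_nonneg _) (by positivity)).1 ?_
  change ‖Φ (x + h) - Φ x - D₀ h‖ ^ 2 ≤ _
  rw [norm_sub_sq_real, ← real_inner_self_eq_norm_sq, ← real_inner_self_eq_norm_sq, hinner]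
  have h4 : 0 ≤ ‖h‖ * ‖h‖ := by positivity
  rw [mul_pow]
  nlinarith [h1.2, h2'.1]

end Increments

/-! ### Mixed derivatives of the kernel and regularity of its RKHS. -/

section Kernel

variable {d : ℕ} {U : Set (EuclideanSpace ℝ (Fin d))}
  {K : EuclideanSpace ℝ (Fin d) → EuclideanSpace ℝ (Fin d) →
    (EuclideanSpace ℝ (Fin d) →L[ℝ] EuclideanSpace ℝ (Fin d))}
  {x h k v : EuclideanSpace ℝ (Fin d)}

theorem eq_sum_smul_stdVec (h : EuclideanSpace ℝ (Fin d)) : h = ∑ i, h i • stdVec i := by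
  simpa [stdVec] using ((EuclideanSpace.basisFun (Fin d) ℝ).sum_repr h).symm

/-- Second differences of the kernel are given by its mixed second derivatives. -/
theorem exists_second_difference_eq (hU : IsOpen U) (hUc : Convex ℝ U) (hK : MixedC1 U K)
    (hx : x ∈ U) (hh : x + h ∈ U) (hk : x + k ∈ U) :
    ∃ a ∈ segment ℝ x (x + k), ∃ b ∈ segment ℝ x (x + h),
      ⟪K (x + k) (x + h) v, v⟫_ℝ - ⟪K x (x + h) v, v⟫_ℝ
          - (⟪K (x + k) x v, v⟫_ℝ - ⟪K x x v, v⟫_ℝ)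
        = ∑ i, ∑ j, ⟪mixedPartial K i j a b v, v⟫_ℝ * (h j * k i) := by
  let ev : (EuclideanSpace ℝ (Fin d) →L[ℝ] EuclideanSpace ℝ (Fin d)) →L[ℝ] ℝ :=
    (innerSL ℝ v).comp (ContinuousLinearMap.apply ℝ _ v)
  have hev : ∀ F, ev F = ⟪F v, v⟫_ℝ := fun F => by
    change ⟪v, F v⟫_ℝ = _
    exact real_inner_comm _ _
  have hdK : ∀ a ∈ U, ∀ b ∈ U, HasFDerivAt (fun b => ev (K a b)) (ev.comp (fderiv ℝ (K a) b)) b :=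
    fun a ha b hb => ev.hasFDerivAt.comp b
      ((hK.diff_right a ha b hb).differentiableAt (hU.mem_nhds hb)).hasFDerivAt
  -- Mean value theorem in the second variable for the difference in the first; then, at this b, in
  -- the first variable. In between h is expanded in the basis, since `MixedC1` only differentiates
  -- derivatives along basis vectors.
  obtain ⟨b, hb, hb'⟩ := domain_mvt (f := fun b => ev (K (x + k) b) - ev (K x b))
    (fun b hb => ((hdK _ hk b hb).sub (hdK _ hx b hb)).hasFDerivWithinAt) hUc hx hh
  have hbU : b ∈ U := hUc.segment_subset hx hh hb
  have hdP : ∀ a ∈ U, HasFDerivAt (fun a => ∑ j, h j • ev (fderiv ℝ (K a) b (stdVec j)))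
      (∑ j, h j • ev.comp (fderiv ℝ (fun a => fderiv ℝ (K a) b (stdVec j)) a)) a := fun a ha =>
    HasFDerivAt.fun_sum fun j _ => (ev.hasFDerivAt.comp a ((hK.diff_left j b hbU a
      ha).differentiableAt (hU.mem_nhds ha)).hasFDerivAt).const_smul (h j)
  obtain ⟨a, ha, ha'⟩ := domain_mvt (fun a ha => (hdP a ha).hasFDerivWithinAt) hUc hx hk
  refine ⟨a, ha, b, hb, ?_⟩
  simp only [← hev]
  have e1 : ∀ a, ev (fderiv ℝ (K a) b h) = ∑ j, h j • ev (fderiv ℝ (K a) b (stdVec j)) := by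
    intro a
    conv_lhs => rw [eq_sum_smul_stdVec h]
    simp only [map_sum, map_smul]
  have e2 : ∀ j, ev (fderiv ℝ (fun a => fderiv ℝ (K a) b (stdVec j)) a k)
      = ∑ i, k i * ev (mixedPartial K i j a b) := by
    intro j
    conv_lhs => rw [eq_sum_smul_stdVec k]
    simp only [map_sum, map_smul, mixedPartial, smul_eq_mul]
  simp only [add_sub_cancel_left, sub_apply, ContinuousLinearMap.comp_apply, e1] at hb'
  simp only [add_sub_cancel_left, sum_apply, smul_apply, ContinuousLinearMap.comp_apply, e2] at ha'
  rw [hb', ha', Finset.sum_comm]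
  refine Finset.sum_congr rfl fun j _ => ?_
  rw [smul_eq_mul, Finset.mul_sum]
  exact Finset.sum_congr rfl fun i _ => by ring

end Kernel

section RKHS

variable {d : ℕ} {Θ : Set (EuclideanSpace ℝ (Fin d))} {H : Type*} [NormedAddCommGroup H]
  [InnerProductSpace ℝ H] [RKHS ℝ H (interior Θ) (EuclideanSpace ℝ (Fin d))]
  {K : EuclideanSpace ℝ (Fin d) → EuclideanSpace ℝ (Fin d) →
    (EuclideanSpace ℝ (Fin d) →L[ℝ] EuclideanSpace ℝ (Fin d))}
  {θ : EuclideanSpace ℝ (Fin d)}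

theorem toField_apply (f : H) (hθ : θ ∈ interior Θ) : toField f θ = f ⟨θ, hθ⟩ :=
  Subtype.val_injective.extend_apply (fun θ : interior Θ => f θ) 0 ⟨θ, hθ⟩

variable [CompleteSpace H]

variable (H) in
/-- The feature map `θ ↦ K(·, θ) v`, extended by zero outside of the interior of `Θ`. -/
def feature (v : EuclideanSpace ℝ (Fin d)) (θ : EuclideanSpace ℝ (Fin d)) : H :=
  Function.extend Subtype.val (fun θ : interior Θ => RKHS.kerFun H θ v) 0 θ

theorem feature_apply (v : EuclideanSpace ℝ (Fin d)) (hθ : θ ∈ interior Θ) :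
    feature H v θ = RKHS.kerFun H ⟨θ, hθ⟩ v :=
  Subtype.val_injective.extend_apply (fun θ : interior Θ => RKHS.kerFun H θ v) 0 ⟨θ, hθ⟩

theorem inner_feature (f : H) (v : EuclideanSpace ℝ (Fin d)) (hθ : θ ∈ interior Θ) :
    ⟪f, feature H v θ⟫_ℝ = ⟪toField f θ, v⟫_ℝ := by
  rw [feature_apply v hθ, RKHS.inner_kerFun, toField_apply f hθ]

theorem inner_feature_feature (hK : ∀ θ θ' : interior Θ, RKHS.kernel H θ θ' = K θ θ')
    (v w : EuclideanSpace ℝ (Fin d)) {a b : EuclideanSpace ℝ (Fin d)} (ha : a ∈ interior Θ)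
    (hb : b ∈ interior Θ) : ⟪feature H v b, feature H w a⟫_ℝ = ⟪K a b v, w⟫_ℝ := by
  rw [feature_apply v hb, feature_apply w ha, ← RKHS.kernel_inner, hK]

/-- The feature map of a kernel with continuous mixed second derivatives is differentiable. -/
theorem exists_hasFDerivAt_feature (hΘ : Convex ℝ Θ)
    (hK : ∀ θ θ' : interior Θ, RKHS.kernel H θ θ' = K θ θ') (hK' : MixedC1 (interior Θ) K)
    (v : EuclideanSpace ℝ (Fin d)) (hθ : θ ∈ interior Θ) :
    ∃ D : EuclideanSpace ℝ (Fin d) →L[ℝ] H, HasFDerivAt (feature H v) D θ ∧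
      ∀ j, ‖D (stdVec j)‖ ^ 2 = ⟪mixedPartial K j j θ θ v, v⟫_ℝ := by
  let m : Fin d → Fin d → EuclideanSpace ℝ (Fin d) × EuclideanSpace ℝ (Fin d) → ℝ :=
    fun i j z => ⟪mixedPartial K i j z.1 z.2 v, v⟫_ℝ
  let π : Fin d → (EuclideanSpace ℝ (Fin d) →L[ℝ] ℝ) := fun i => EuclideanSpace.proj i
  let B : EuclideanSpace ℝ (Fin d) →L[ℝ] EuclideanSpace ℝ (Fin d) →L[ℝ] ℝ :=
    ∑ i, ∑ j, m i j (θ, θ) • (π j).smulRight (π i)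
  have hBapp : ∀ h k, B h k = ∑ i, ∑ j, m i j (θ, θ) * (h j * k i) := by
    intro h k
    simp [B, π, sum_apply]
  have hcont : ∀ ε > 0, ∃ δ > 0, ∀ a b, ‖a - θ‖ < δ → ‖b - θ‖ < δ →
      ∀ i j, |m i j (a, b) - m i j (θ, θ)| ≤ ε := by
    intro ε hε
    have hev : ∀ᶠ z in 𝓝 (θ, θ), ∀ i j, |m i j z - m i j (θ, θ)| ≤ ε := by
      rw [eventually_all]
      intro i
      rw [eventually_all]
      intro j
      have h1 : ContinuousAt (fun z : EuclideanSpace ℝ (Fin d) × EuclideanSpace ℝ (Fin d) =>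
          mixedPartial K i j z.1 z.2) (θ, θ) :=
        (hK'.cont i j).continuousAt
          ((isOpen_interior.prod isOpen_interior).mem_nhds ⟨hθ, hθ⟩)
      have h2 : ContinuousAt (m i j) (θ, θ) :=
        (h1.clm_apply continuousAt_const).inner continuousAt_const
      have h3 := Metric.continuousAt_iff'.1 h2 ε hε
      exact h3.mono fun z hz => (Real.dist_eq _ _ ▸ hz).le
    rw [Metric.eventually_nhds_iff] at hev
    obtain ⟨δ, hδ, h⟩ := hev
    refine ⟨δ, hδ, fun a b ha hb => h ?_⟩
    rw [Prod.dist_eq, dist_eq_norm, dist_eq_norm]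
    exact max_lt ha hb
  obtain ⟨D, hD, hDB⟩ := exists_hasFDerivAt_of_inner_increments (Φ := feature H v) (x := θ)
    (B := B) (by
      intro ε hε
      -- There are d² mixed derivatives to control; the added 1 keeps the denominator positive when
      -- d = 0.
      obtain ⟨δ₁, hδ₁, h1⟩ := hcont (ε / ((d : ℝ) * d + 1)) (by positivity)
      obtain ⟨δ₂, hδ₂, h2⟩ := Metric.isOpen_iff.1 isOpen_interior θ hθ
      refine ⟨min δ₁ δ₂, lt_min hδ₁ hδ₂, fun h k hh hk => ?_⟩
      have hmem : ∀ u, ‖u‖ < min δ₁ δ₂ → θ + u ∈ interior Θ := fun u hu =>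
        h2 (by simpa using hu.trans_le (min_le_right _ _))
      obtain ⟨a, ha, b, hb, hab⟩ := exists_second_difference_eq (v := v) isOpen_interior
        hΘ.interior hK' hθ (hmem h hh) (hmem k hk)
      have hseg : ∀ u c, ‖u‖ < min δ₁ δ₂ → c ∈ segment ℝ θ (θ + u) → ‖c - θ‖ < δ₁ := by
        intro u c hu hc
        rw [segment_eq_image'] at hc
        obtain ⟨t, ht, rfl⟩ := hc
        simp only [add_sub_cancel_left, norm_smul, Real.norm_eq_abs, abs_of_nonneg ht.1]
        exact (mul_le_of_le_one_left (norm_nonneg _) ht.2).trans_lt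
          (hu.trans_le (min_le_left _ _))
      have h3 := h1 a b (hseg k a hk ha) (hseg h b hh hb)
      have e : ⟪feature H v (θ + h) - feature H v θ, feature H v (θ + k) - feature H v θ⟫_ℝ =
          ⟪K (θ + k) (θ + h) v, v⟫_ℝ - ⟪K θ (θ + h) v, v⟫_ℝ
            - (⟪K (θ + k) θ v, v⟫_ℝ - ⟪K θ θ v, v⟫_ℝ) := by
        simp only [inner_sub_left, inner_sub_right]
        rw [inner_feature_feature hK v v (hmem k hk) (hmem h hh),
          inner_feature_feature hK v v (hmem k hk) hθ,
          inner_feature_feature hK v v hθ (hmem h hh), inner_feature_feature hK v v hθ hθ]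
        ring
      rw [e, hab, hBapp, ← Finset.sum_sub_distrib]
      simp only [← Finset.sum_sub_distrib, ← sub_mul]
      calc |∑ i, ∑ j, (m i j (a, b) - m i j (θ, θ)) * (h j * k i)|
          ≤ ∑ i : Fin d, ∑ j : Fin d, ε / ((d : ℝ) * d + 1) * (‖h‖ * ‖k‖) := by
            refine (Finset.abs_sum_le_sum_abs _ _).trans (Finset.sum_le_sum fun i _ => ?_)
            refine (Finset.abs_sum_le_sum_abs _ _).trans (Finset.sum_le_sum fun j _ => ?_)
            rw [abs_mul, abs_mul]
            refine mul_le_mul (h3 i j) ?_ (by positivity) (by positivity)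
            exact mul_le_mul (PiLp.norm_apply_le h j) (PiLp.norm_apply_le k i) (abs_nonneg _)
              (norm_nonneg _)
        _ = ε * (((d : ℝ) * d) / ((d : ℝ) * d + 1)) * (‖h‖ * ‖k‖) := by
            simp only [Finset.sum_const, Finset.card_univ, Fintype.card_fin, nsmul_eq_mul]
            ring
        _ ≤ ε * 1 * (‖h‖ * ‖k‖) := by
            refine mul_le_mul_of_nonneg_right (mul_le_mul_of_nonneg_left ?_ hε.le) (by positivity)
            rw [div_le_one (by positivity)]
            linarith
        _ = ε * (‖h‖ * ‖k‖) := by rw [mul_one])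
  refine ⟨D, hD, fun j => ?_⟩
  rw [← real_inner_self_eq_norm_sq, hDB, hBapp]
  simp only [stdVec, PiLp.single_apply]
  rw [Finset.sum_eq_single j, Finset.sum_eq_single j]
  · simp [m]
  · intro b _ hb; simp [hb]
  · simp
  · intro b _ hb; simp [hb]
  · simp

/-- By the reproducing property the i-th coordinate of f is the inner product of f with the feature
map of eᵢ. -/
theorem differentiableAt_toField (hΘ : Convex ℝ Θ)
    (hK : ∀ θ θ' : interior Θ, RKHS.kernel H θ θ' = K θ θ') (hK' : MixedC1 (interior Θ) K)
    (f : H) (hθ : θ ∈ interior Θ) : DifferentiableAt ℝ (toField f) θ := by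
  rw [differentiableAt_euclidean]
  intro i
  obtain ⟨D, hD, -⟩ := exists_hasFDerivAt_feature hΘ hK hK' (stdVec i) hθ
  have h1 : DifferentiableAt ℝ (fun x => ⟪f, feature H (stdVec i) x⟫_ℝ) θ :=
    (differentiableAt_const f).inner ℝ hD.differentiableAt
  refine h1.congr_of_eventuallyEq ?_
  filter_upwards [isOpen_interior.mem_nhds hθ] with x hx
  rw [inner_feature f _ hx, stdVec, real_inner_comm, EuclideanSpace.inner_single_left]
  simp

/-- Test the derivative v = ∂ⱼf against itself: ‖v‖² = ⟪f, ∂ⱼΦ⟫ for the feature map Φ of v, while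
‖∂ⱼΦ‖² is a diagonal mixed derivative of K evaluated at v. Cauchy-Schwarz, then cancellation of
‖v‖², gives the bound. -/
theorem norm_fderiv_toField_le (hΘ : Convex ℝ Θ)
    (hK : ∀ θ θ' : interior Θ, RKHS.kernel H θ θ' = K θ θ') (hK' : MixedC1 (interior Θ) K)
    (f : H) (hθ : θ ∈ interior Θ) (j : Fin d) :
    ‖fderiv ℝ (toField f) θ (stdVec j)‖ ^ 2 ≤ ‖mixedPartial K j j θ θ‖ * ‖f‖ ^ 2 := by
  set v := fderiv ℝ (toField f) θ (stdVec j) with hv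
  obtain ⟨D, hD, hDn⟩ := exists_hasFDerivAt_feature hΘ hK hK' v hθ
  have h1 : HasFDerivAt (fun x => ⟪toField f x, v⟫_ℝ) ((innerSL ℝ f).comp D) θ := by
    have : HasFDerivAt (fun x => ⟪f, feature H v x⟫_ℝ) ((innerSL ℝ f).comp D) θ :=
      (innerSL ℝ f).hasFDerivAt.comp θ hD
    refine this.congr_of_eventuallyEq ?_
    filter_upwards [isOpen_interior.mem_nhds hθ] with x hx
    rw [inner_feature f _ hx]
  have h2 := (differentiableAt_toField hΘ hK hK' f hθ).hasFDerivAt.inner ℝ (hasFDerivAt_const v θ)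
  have h3 := congrArg (fun F => F (stdVec j)) (h2.unique h1)
  have h4 : ‖v‖ ^ 2 = ⟪f, D (stdVec j)⟫_ℝ := by
    rw [← real_inner_self_eq_norm_sq]
    simpa [← hv] using h3
  have h5 : ‖v‖ ^ 2 ≤ ‖f‖ * ‖D (stdVec j)‖ := h4 ▸ real_inner_le_norm _ _
  have h6 : ‖D (stdVec j)‖ ^ 2 ≤ ‖mixedPartial K j j θ θ‖ * ‖v‖ ^ 2 := by
    rw [hDn]
    calc _ ≤ ‖mixedPartial K j j θ θ v‖ * ‖v‖ := real_inner_le_norm _ _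
      _ ≤ ‖mixedPartial K j j θ θ‖ * ‖v‖ * ‖v‖ := by
        gcongr; exact ContinuousLinearMap.le_opNorm _ _
      _ = _ := by ring
  rcases eq_or_ne v 0 with h0 | h0
  · rw [h0, norm_zero, zero_pow two_ne_zero]; positivity
  · have h7 : 0 < ‖v‖ ^ 2 := by positivity
    have h8 : (‖v‖ ^ 2) ^ 2 ≤ ‖f‖ ^ 2 * (‖mixedPartial K j j θ θ‖ * ‖v‖ ^ 2) :=
      calc (‖v‖ ^ 2) ^ 2 ≤ (‖f‖ * ‖D (stdVec j)‖) ^ 2 := by gcongr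
        _ = ‖f‖ ^ 2 * ‖D (stdVec j)‖ ^ 2 := by ring
        _ ≤ _ := by gcongr
    nlinarith

end RKHS

end

section

/-! ### Traces, Hilbert-Schmidt norms and the logarithm of the determinant. -/

section HilbertSchmidt

variable {E : Type*} [NormedAddCommGroup E] [InnerProductSpace ℝ E]
  {ι : Type*} [Fintype ι]

theorem opTrace_eq_sum (F : E →L[ℝ] E) (b : OrthonormalBasis ι ℝ E) :
    opTrace F = ∑ i, ⟪F (b i), b i⟫_ℝ := by
  rw [opTrace, LinearMap.trace_eq_sum_inner _ b]
  exact Finset.sum_congr rfl fun i _ => real_inner_comm _ _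

theorem opTrace_smul (c : ℝ) (F : E →L[ℝ] E) : opTrace (c • F) = c * opTrace F := by
  simp [opTrace]

theorem opTrace_add (F G : E →L[ℝ] E) : opTrace (F + G) = opTrace F + opTrace G := by
  simp [opTrace]

variable [FiniteDimensional ℝ E]

/-- The squared Hilbert-Schmidt norm. -/
def hsSq (F : E →L[ℝ] E) : ℝ := opTrace (ContinuousLinearMap.adjoint F ∘L F)

theorem hsSq_eq_sum (F : E →L[ℝ] E) (b : OrthonormalBasis ι ℝ E) :
    hsSq F = ∑ i, ‖F (b i)‖ ^ 2 := by
  rw [hsSq, opTrace_eq_sum _ b]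
  refine Finset.sum_congr rfl fun i _ => ?_
  rw [ContinuousLinearMap.comp_apply, ContinuousLinearMap.adjoint_inner_left,
    real_inner_self_eq_norm_sq]

theorem hsSq_adjoint (F : E →L[ℝ] E) : hsSq (ContinuousLinearMap.adjoint F) = hsSq F := by
  rw [hsSq, hsSq, ContinuousLinearMap.adjoint_adjoint]
  exact LinearMap.trace_mul_comm ℝ (F : E →ₗ[ℝ] E)
    ((ContinuousLinearMap.adjoint F : E →L[ℝ] E) : E →ₗ[ℝ] E)

theorem hsSq_nonneg (F : E →L[ℝ] E) : 0 ≤ hsSq F := by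
  rw [hsSq_eq_sum F (stdOrthonormalBasis ℝ E)]
  positivity

/-- Passing to adjoints puts A* on the outside, where its operator norm can be used on each basis
vector. -/
theorem hsSq_comp_le (F A : E →L[ℝ] E) : hsSq (F ∘L A) ≤ ‖A‖ ^ 2 * hsSq F := by
  rw [← hsSq_adjoint, ← hsSq_adjoint F, ContinuousLinearMap.adjoint_comp,
    hsSq_eq_sum _ (stdOrthonormalBasis ℝ E), hsSq_eq_sum _ (stdOrthonormalBasis ℝ E),
    Finset.mul_sum]
  refine Finset.sum_le_sum fun i _ => ?_
  rw [← mul_pow, ContinuousLinearMap.comp_apply]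
  refine pow_le_pow_left₀ (norm_nonneg _) ?_ 2
  refine (ContinuousLinearMap.le_opNorm _ _).trans_eq ?_
  rw [LinearIsometryEquiv.norm_map]

theorem sq_opTrace_le (F : E →L[ℝ] E) : opTrace F ^ 2 ≤ Module.finrank ℝ E * hsSq F := by
  let b := stdOrthonormalBasis ℝ E
  rw [opTrace_eq_sum F b, hsSq_eq_sum F b]
  refine sq_sum_le_card_mul_sum_sq.trans ?_
  rw [Finset.card_univ, Fintype.card_fin]
  refine mul_le_mul_of_nonneg_left (Finset.sum_le_sum fun i _ => ?_) (Nat.cast_nonneg _)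
  have h := abs_real_inner_le_norm (F (b i)) (b i)
  rw [b.norm_eq_one, mul_one] at h
  exact sq_le_sq' (abs_le.1 h).1 (abs_le.1 h).2

theorem hsSq_smul (c : ℝ) (F : E →L[ℝ] E) : hsSq (c • F) = c ^ 2 * hsSq F := by
  rw [hsSq_eq_sum _ (stdOrthonormalBasis ℝ E), hsSq_eq_sum _ (stdOrthonormalBasis ℝ E),
    Finset.mul_sum]
  refine Finset.sum_congr rfl fun i _ => ?_
  rw [smul_apply, norm_smul, mul_pow, Real.norm_eq_abs, sq_abs]

theorem det_adjoint (F : E →L[ℝ] E) : (ContinuousLinearMap.adjoint F).det = F.det := by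
  let b := stdOrthonormalBasis ℝ E
  have h : ((ContinuousLinearMap.adjoint F : E →L[ℝ] E) : E →ₗ[ℝ] E)
      = LinearMap.adjoint (F : E →ₗ[ℝ] E) := by
    rw [LinearMap.eq_adjoint_iff]
    intro x y
    exact ContinuousLinearMap.adjoint_inner_left F y x
  rw [ContinuousLinearMap.det, ContinuousLinearMap.det, h, ← LinearMap.det_toMatrix b.toBasis,
    ← LinearMap.det_toMatrix b.toBasis, LinearMap.toMatrix_adjoint, Matrix.det_conjTranspose]
  simp

end HilbertSchmidt

section LogDet

/-- The range s ≥ -1/2 is the one needed for s = 2⟪Bu, u⟫ with |⟪Bu, u⟫| ≤ 1/4. For negative s a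
quadratic lower bound for exp(s² - s) is enough. -/
theorem sub_sq_le_log_one_add {s : ℝ} (hs : -(1 / 2) ≤ s) : s - s ^ 2 ≤ Real.log (1 + s) := by
  have h1 : 0 < 1 + s := by linarith
  rw [Real.le_log_iff_exp_le h1]
  rcases le_or_gt 0 s with h0 | h0
  · have h2 : Real.exp s ≤ Real.exp (s ^ 2) * (1 + s) := by
      have h3 : 1 + s ^ 2 ≤ Real.exp (s ^ 2) := by linarith [Real.add_one_le_exp (s ^ 2)]
      have h4 := Real.add_one_le_exp (-(s / (1 + s)))
      have h5 : Real.exp (s / (1 + s)) ≤ 1 + s := by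
        rw [← inv_le_inv₀ h1 (Real.exp_pos _), ← Real.exp_neg]
        refine le_trans (le_of_eq ?_) h4
        field_simp
        ring
      have h6 : Real.exp s ≤ Real.exp (s ^ 2) * Real.exp (s / (1 + s)) := by
        rw [← Real.exp_add]
        refine Real.exp_le_exp.2 ?_
        have : s ^ 2 + s / (1 + s) - s = s ^ 3 / (1 + s) := by field_simp; ring
        have : 0 ≤ s ^ 3 / (1 + s) := by positivity
        linarith
      exact h6.trans (mul_le_mul_of_nonneg_left h5 (Real.exp_pos _).le)
    rw [Real.exp_sub, div_le_iff₀ (Real.exp_pos _)]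
    linarith
  · have h2 := Real.quadratic_le_exp_of_nonneg (x := s ^ 2 - s) (by nlinarith)
    have h3 : 1 ≤ (1 + s) * (1 + (s ^ 2 - s) + (s ^ 2 - s) ^ 2 / 2) := by
      have : (1 + s) * (1 + (s ^ 2 - s) + (s ^ 2 - s) ^ 2 / 2)
          = 1 + s ^ 2 * ((1 + s - s ^ 2 + s ^ 3) / 2) := by ring
      rw [this]
      have h4 : 0 ≤ 1 + s - s ^ 2 + s ^ 3 := by nlinarith [sq_nonneg s]
      nlinarith [sq_nonneg s, mul_nonneg (sq_nonneg s) h4]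
    have h4 : 1 ≤ (1 + s) * Real.exp (s ^ 2 - s) :=
      h3.trans (mul_le_mul_of_nonneg_left h2 h1.le)
    have h5 : Real.exp (s - s ^ 2) = (Real.exp (s ^ 2 - s))⁻¹ := by
      rw [← Real.exp_neg]; congr 1; ring
    rw [h5, inv_le_iff_one_le_mul₀ (Real.exp_pos _)]
    exact h4

variable {E : Type*} [NormedAddCommGroup E] [InnerProductSpace ℝ E] [FiniteDimensional ℝ E]

/-- Two-sided second-order bounds for `log |det (1 + B)|`. -/
theorem log_abs_det_one_add_bounds {B : E →L[ℝ] E} (hB : ∀ v, |⟪B v, v⟫_ℝ| ≤ 1 / 4 * ‖v‖ ^ 2) :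
    (1 + B).det ≠ 0 ∧ opTrace B - 2 * hsSq B ≤ Real.log |(1 + B).det| ∧
      Real.log |(1 + B).det| ≤ opTrace B + hsSq B / 2 := by
  -- B need not be symmetric and ‖B‖ need not be small, so diagonalise (1 + B)*(1 + B) instead. Its
  -- determinant is det(1 + B)², and its eigenvalues are ‖(1 + B)u‖² = 1 + 2⟪Bu, u⟫ + ‖Bu‖².
  let M : E →L[ℝ] E := ContinuousLinearMap.adjoint (1 + B) ∘L (1 + B)
  have hM : (M : E →ₗ[ℝ] E).IsSymmetric := by
    intro x y
    simp only [M, ContinuousLinearMap.coe_coe, ContinuousLinearMap.comp_apply,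
      ContinuousLinearMap.adjoint_inner_left, ContinuousLinearMap.adjoint_inner_right]
  let u := hM.eigenvectorBasis rfl
  let μ := hM.eigenvalues rfl
  have hμ : ∀ i, μ i = 1 + 2 * ⟪B (u i), u i⟫_ℝ + ‖B (u i)‖ ^ 2 := by
    intro i
    have h1 : M (u i) = μ i • u i := hM.apply_eigenvectorBasis rfl i
    have h2 : ⟪M (u i), u i⟫_ℝ = μ i := by
      rw [h1, real_inner_smul_left, real_inner_self_eq_norm_sq, u.norm_eq_one]
      ring
    rw [← h2, ContinuousLinearMap.comp_apply, ContinuousLinearMap.adjoint_inner_left,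
      real_inner_self_eq_norm_sq, add_apply, norm_add_sq_real, one_apply_eq_self,
      u.norm_eq_one, real_inner_comm]
    ring
  have hs : ∀ i, |⟪B (u i), u i⟫_ℝ| ≤ 1 / 4 := by
    intro i
    simpa [u.norm_eq_one] using hB (u i)
  have hμpos : ∀ i, 0 < μ i := by
    intro i
    rw [hμ]
    have := (abs_le.1 (hs i)).1
    nlinarith [sq_nonneg ‖B (u i)‖]
  have hdet : (1 + B).det ^ 2 = ∏ i, μ i := by
    have h1 : M.det = ∏ i, μ i := by
      simpa using hM.det_eq_prod_eigenvalues rfl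
    rw [← h1, sq]
    conv_lhs => rw [← det_adjoint]
    conv_lhs => rhs; rw [← det_adjoint, ContinuousLinearMap.adjoint_adjoint]
    exact (LinearMap.det_comp _ _).symm
  have hne : (1 + B).det ≠ 0 := by
    intro h0
    rw [h0, zero_pow two_ne_zero] at hdet
    exact (Finset.prod_pos fun i _ => hμpos i).ne hdet
  have hlog : 2 * Real.log |(1 + B).det| = ∑ i, Real.log (μ i) := by
    rw [← Real.log_prod fun i _ => (hμpos i).ne', ← hdet, Real.log_abs, Real.log_pow]
    norm_num
  have htr := opTrace_eq_sum B u
  have hhs := hsSq_eq_sum B u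
  refine ⟨hne, ?_, ?_⟩
  -- Drop ‖Bu‖² from the eigenvalue and use log(1 + s) ≥ s - s² at s = 2⟪Bu, u⟫, where s² ≤ 4‖Bu‖².
  · have : ∑ i, (2 * ⟪B (u i), u i⟫_ℝ - 4 * ‖B (u i)‖ ^ 2) ≤ ∑ i, Real.log (μ i) := by
      refine Finset.sum_le_sum fun i _ => ?_
      have h1 := abs_le.1 (hs i)
      have h2 := sub_sq_le_log_one_add (s := 2 * ⟪B (u i), u i⟫_ℝ) (by linarith [h1.1])
      have h3 : Real.log (1 + 2 * ⟪B (u i), u i⟫_ℝ) ≤ Real.log (μ i) := by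
        refine Real.log_le_log (by linarith [h1.1]) ?_
        rw [hμ]
        linarith [sq_nonneg ‖B (u i)‖]
      have h4 := abs_real_inner_le_norm (B (u i)) (u i)
      rw [u.norm_eq_one, mul_one] at h4
      have h5 := sq_le_sq' (abs_le.1 h4).1 (abs_le.1 h4).2
      nlinarith
    rw [Finset.sum_sub_distrib, ← Finset.mul_sum, ← Finset.mul_sum, ← htr, ← hhs, ← hlog] at this
    linarith
  · have : ∑ i, Real.log (μ i) ≤ ∑ i, (2 * ⟪B (u i), u i⟫_ℝ + ‖B (u i)‖ ^ 2) := by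
      refine Finset.sum_le_sum fun i _ => ?_
      have h1 := Real.log_le_sub_one_of_pos (hμpos i)
      rw [hμ] at h1 ⊢
      linarith
    rw [Finset.sum_add_distrib, ← Finset.mul_sum, ← htr, ← hhs, ← hlog] at this
    linarith

end LogDet

end

section

/-! ### Transformations of the Kullback-Leibler divergence. -/

section KullbackLeibler

open InformationTheory

variable {X Y : Type*} [MeasurableSpace X] [MeasurableSpace Y] {μ ν : Measure X}

/-- The Kullback-Leibler divergence is invariant under maps with a measurable left inverse. -/
theorem klDiv_map_of_leftInverse [IsFiniteMeasure μ] [IsFiniteMeasure ν] {f : X → Y} {g : Y → X}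
    (hf : Measurable f) (hg : Measurable g) (hgf : Function.LeftInverse g f) :
    klDiv (μ.map f) (ν.map f) = klDiv μ ν := by
  refine le_antisymm (klDiv_map_le μ ν hf) ?_
  have h := klDiv_map_le (μ.map f) (ν.map f) hg
  rwa [Measure.map_map hg hf, Measure.map_map hg hf, hgf.comp_eq_id, Measure.map_id,
    Measure.map_id] at h

/-- Young's inequality for a log a - a and its conjugate exp b, a consequence of 1 + x ≤ exp x at x
= b - log a. -/
theorem mul_le_klFun_add_exp {a : ℝ} (ha : 0 ≤ a) (b : ℝ) : a * b ≤ klFun a + Real.exp b := by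
  rw [klFun_apply]
  rcases ha.eq_or_lt with rfl | ha
  · have := Real.exp_pos b
    simp only [zero_mul, Real.log_zero]
    linarith
  · have h1 := Real.add_one_le_exp (b - Real.log a)
    rw [Real.exp_sub, Real.exp_log ha, le_div_iff₀ ha] at h1
    linarith

/-- Finite relative entropy and finite exponential moments imply integrability. -/
theorem integrable_of_klDiv_ne_top [IsFiniteMeasure μ] [IsFiniteMeasure ν]
    (hμν : klDiv μ ν ≠ ∞) {f : X → ℝ} (hf : Measurable f)
    (hexp : Integrable (fun x => Real.exp |f x|) ν) : Integrable f μ := by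
  obtain ⟨hac, hllr⟩ := klDiv_ne_top_iff.1 hμν
  rw [← integrable_rnDeriv_smul_iff hac]
  have h1 : Integrable (fun x => klFun (μ.rnDeriv ν x).toReal) ν :=
    (integrable_klFun_rnDeriv_iff hac).2 hllr
  refine (h1.add hexp).mono' ?_ (Eventually.of_forall fun x => ?_)
  · exact ((μ.measurable_rnDeriv ν).ennreal_toReal.smul hf).aestronglyMeasurable
  · rw [norm_smul, Real.norm_of_nonneg ENNReal.toReal_nonneg, Real.norm_eq_abs]
    exact mul_le_klFun_add_exp ENNReal.toReal_nonneg _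

/-- Change of the reference measure in the Kullback-Leibler divergence. -/
theorem klDiv_withDensity_right [IsProbabilityMeasure μ] [IsProbabilityMeasure ν] {r : X → ℝ}
    (hr : Measurable r) (hrpos : ∀ x, 0 < r x)
    (hprob : IsProbabilityMeasure (ν.withDensity fun x => ENNReal.ofReal (r x)))
    (hμν : klDiv μ ν ≠ ∞) (hint : Integrable (fun x => Real.log (r x)) μ) :
    klDiv μ (ν.withDensity fun x => ENNReal.ofReal (r x)) ≠ ∞ ∧
      (klDiv μ (ν.withDensity fun x => ENNReal.ofReal (r x))).toReal
        = (klDiv μ ν).toReal - ∫ x, Real.log (r x) ∂μ := by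
  obtain ⟨hac, hllr⟩ := klDiv_ne_top_iff.1 hμν
  have hne : ∀ x, ENNReal.ofReal (r x) ≠ 0 := fun x => by simpa using hrpos x
  have hac' : μ ≪ ν.withDensity fun x => ENNReal.ofReal (r x) :=
    hac.trans (withDensity_absolutelyContinuous' hr.ennreal_ofReal.aemeasurable
      (Eventually.of_forall hne))
  have hae : llr μ (ν.withDensity fun x => ENNReal.ofReal (r x)) =ᵐ[μ]
      fun x => llr μ ν x - Real.log (r x) := by
    have h1 := hac.ae_le (Measure.rnDeriv_withDensity_right μ ν hr.ennreal_ofReal.aemeasurable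
      (Eventually.of_forall hne) (Eventually.of_forall fun x => ENNReal.ofReal_ne_top))
    filter_upwards [h1, Measure.rnDeriv_pos hac, hac.ae_le (Measure.rnDeriv_ne_top μ ν)]
      with x hx hx0 hxt
    rw [llr, llr, hx, ENNReal.toReal_mul, ENNReal.toReal_inv, ENNReal.toReal_ofReal (hrpos x).le,
      Real.log_mul (inv_pos.2 (hrpos x)).ne' (ENNReal.toReal_pos hx0.ne' hxt).ne', Real.log_inv]
    ring
  refine ⟨klDiv_ne_top hac' ((hllr.sub hint).congr hae.symm), ?_⟩
  rw [toReal_klDiv_of_measure_eq hac' (by simp), toReal_klDiv_of_measure_eq hac (by simp),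
    integral_congr_ae hae, integral_sub hllr hint]

end KullbackLeibler

/-! ### Global inversion and change of variables. -/

section Diffeomorphism

variable {E : Type*} [NormedAddCommGroup E] [InnerProductSpace ℝ E]
  {F : E → E} {F' : E → E →L[ℝ] E} {c : ℝ}

/-- A map with coercive derivative is strongly monotone. -/
theorem mul_sq_le_inner_sub_of_coercive (hF : ∀ x, HasFDerivAt F (F' x) x)
    (hc : ∀ x v, c * ‖v‖ ^ 2 ≤ ⟪F' x v, v⟫_ℝ) (x y : E) :
    c * ‖x - y‖ ^ 2 ≤ ⟪F x - F y, x - y⟫_ℝ := by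
  have h1 : ∀ z ∈ (univ : Set E), HasFDerivWithinAt (fun z => ⟪F z, x - y⟫_ℝ)
      ((innerSL ℝ (x - y)).comp (F' z)) univ z := by
    intro z _
    have h2 : HasFDerivAt (fun z => ⟪x - y, F z⟫_ℝ) ((innerSL ℝ (x - y)).comp (F' z)) z :=
      (innerSL ℝ (x - y)).hasFDerivAt.comp z (hF z)
    exact (h2.congr_of_eventuallyEq
      (Eventually.of_forall fun z => real_inner_comm _ _)).hasFDerivWithinAt
  obtain ⟨z, -, hz⟩ := domain_mvt h1 convex_univ (mem_univ y) (mem_univ x)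
  rw [inner_sub_left, hz, ContinuousLinearMap.comp_apply, innerSL_apply_apply, real_inner_comm]
  exact hc z _

variable [FiniteDimensional ℝ E]

/-- Strong monotonicity makes ‖F x - y‖² tend to infinity, so it has a minimiser. There F' x is
invertible and F x - y is orthogonal to its range, hence zero. -/
theorem surjective_of_coercive (hc0 : 0 < c) (hF : ∀ x, HasFDerivAt F (F' x) x)
    (hc : ∀ x v, c * ‖v‖ ^ 2 ≤ ⟪F' x v, v⟫_ℝ) : Function.Surjective F := by
  intro y
  have hcont : Continuous F := continuous_iff_continuousAt.2 fun x => (hF x).continuousAt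
  have hbound : ∀ x, c * ‖x‖ - ‖F 0 - y‖ ≤ ‖F x - y‖ := by
    intro x
    have h1 := mul_norm_le_of_mul_sq_le_inner (mul_sq_le_inner_sub_of_coercive hF hc x 0)
    rw [sub_zero] at h1
    have h2 : ‖F x - F 0‖ ≤ ‖F x - y‖ + ‖F 0 - y‖ := by
      rw [← sub_sub_sub_cancel_right (F x) (F 0) y]
      exact norm_sub_le _ _
    linarith
  have htend : Tendsto (fun x => ‖F x - y‖ ^ 2) (cocompact E) atTop := by
    refine (tendsto_pow_atTop two_ne_zero).comp ?_
    refine tendsto_atTop_mono hbound ?_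
    exact tendsto_atTop_add_const_right _ _ ((tendsto_norm_cocompact_atTop).const_mul_atTop hc0)
  obtain ⟨x, hx⟩ := ((hcont.sub continuous_const).norm.pow 2).exists_forall_le htend
  refine ⟨x, ?_⟩
  have hd : HasFDerivAt (fun z => ‖F z - y‖ ^ 2) (2 • (innerSL ℝ (F x - y)).comp (F' x)) x :=
    ((hF x).sub_const y).norm_sq
  have h0 := IsLocalMin.hasFDerivAt_eq_zero (f := fun z => ‖F z - y‖ ^ 2)
    (Eventually.of_forall hx) hd
  obtain ⟨e, he⟩ := exists_equiv_of_coercive hc0 (hc x)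
  have h1 := congrArg (fun D => D (e.symm (F x - y))) h0
  rw [← he] at h1
  simp only [smul_apply, ContinuousLinearMap.comp_apply, ContinuousLinearEquiv.coe_coe,
    ContinuousLinearEquiv.apply_symm_apply, innerSL_apply_apply, real_inner_self_eq_norm_sq,
    zero_apply, nsmul_eq_mul] at h1
  have h2 : ‖F x - y‖ ^ 2 = 0 := by simpa using h1
  exact sub_eq_zero.1 (norm_eq_zero.1 (sq_eq_zero_iff.1 h2))

theorem exists_continuous_inverse_of_coercive (hc0 : 0 < c) (hF : ∀ x, HasFDerivAt F (F' x) x)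
    (hc : ∀ x v, c * ‖v‖ ^ 2 ≤ ⟪F' x v, v⟫_ℝ) :
    ∃ G : E → E, Continuous G ∧ Function.LeftInverse G F ∧ Function.RightInverse G F := by
  choose G hG using surjective_of_coercive hc0 hF hc
  have hexp : ∀ x y, c * ‖x - y‖ ≤ ‖F x - F y‖ := fun x y =>
    mul_norm_le_of_mul_sq_le_inner (mul_sq_le_inner_sub_of_coercive hF hc x y)
  refine ⟨G, ?_, fun x => ?_, hG⟩
  · have : LipschitzWith (Real.toNNReal c⁻¹) G := by
      refine LipschitzWith.of_dist_le_mul fun x y => ?_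
      have := hexp (G x) (G y)
      rw [hG, hG] at this
      rw [dist_eq_norm, dist_eq_norm, Real.coe_toNNReal _ (inv_nonneg.2 hc0.le)]
      rwa [le_inv_mul_iff₀ hc0]
    exact this.continuous
  · have := hexp (G (F x)) x
    rw [hG, sub_self, norm_zero] at this
    exact sub_eq_zero.1 (norm_le_zero_iff.1 (nonpos_of_mul_nonpos_right this hc0))

variable [MeasurableSpace E] [BorelSpace E]

/-- The change of variables formula for push-forwards of measures with a density. -/
theorem map_withDensity_abs_det
    (hF : ∀ x, HasFDerivAt F (F' x) x) (hinj : Function.Injective F) (g : E → ℝ≥0∞) :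
    ((volume : Measure E).withDensity
        fun x => ENNReal.ofReal |(F' x).det| * g (F x)).map F
      = (volume.restrict (range F)).withDensity g := by
  have hcont : Continuous F := continuous_iff_continuousAt.2 fun x => (hF x).continuousAt
  ext S hS
  rw [Measure.map_apply hcont.measurable hS, withDensity_apply _ (hcont.measurable hS),
    withDensity_apply _ hS, Measure.restrict_restrict hS,
    ← lintegral_image_eq_lintegral_abs_det_fderiv_mul volume (hcont.measurable hS)
      (fun x _ => (hF x).hasFDerivWithinAt) hinj.injOn, image_preimage_eq_inter_range]

end Diffeomorphism

/-! ### Descent of KL for a log-smooth target. -/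

section SmoothDensity

variable {E : Type*} [NormedAddCommGroup E] [InnerProductSpace ℝ E] [FiniteDimensional ℝ E]
  {V : E → ℝ} {s : E → E} {L : ℝ≥0}

theorem continuous_of_hasGradientAt (hV : ∀ x, HasGradientAt V (s x) x) : Continuous V :=
  continuous_iff_continuousAt.2 fun x => (hV x).continuousAt

theorem le_add_of_lipschitz_gradient (hV : ∀ x, HasGradientAt V (s x) x) (hs : LipschitzWith L s)
    (x h : E) : V (x + h) ≤ V x + ⟪s x, h⟫_ℝ + L / 2 * ‖h‖ ^ 2 := by
  let f : ℝ → ℝ := fun t => V (x + t • h) - t * ⟪s x, h⟫_ℝ - L / 2 * ‖h‖ ^ 2 * t ^ 2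
  have hf : ∀ t, HasDerivAt f (⟪s (x + t • h) - s x, h⟫_ℝ - L * ‖h‖ ^ 2 * t) t := by
    intro t
    have h1 : HasDerivAt (fun t : ℝ => x + t • h) h t := by
      simpa using ((hasDerivAt_id t).smul_const h).const_add x
    have h2 : HasDerivAt (fun t : ℝ => V (x + t • h)) ⟪s (x + t • h), h⟫_ℝ t := by
      have h3 := (hV (x + t • h)).hasFDerivAt.comp_hasDerivAt t h1
      rwa [InnerProductSpace.toDual_apply_apply] at h3
    have h3 := (h2.sub ((hasDerivAt_id t).mul_const ⟪s x, h⟫_ℝ)).sub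
      (((hasDerivAt_id t).pow 2).const_mul (L / 2 * ‖h‖ ^ 2))
    refine h3.congr_deriv ?_
    rw [inner_sub_left]
    simp
    ring
  have hanti : AntitoneOn f (Icc 0 1) := by
    refine antitoneOn_of_deriv_nonpos (convex_Icc 0 1)
      (fun t _ => (hf t).continuousAt.continuousWithinAt)
      (fun t _ => (hf t).differentiableAt.differentiableWithinAt) fun t ht => ?_
    rw [interior_Icc] at ht
    rw [(hf t).deriv]
    have h1 := real_inner_le_norm (s (x + t • h) - s x) h
    have h2 : ‖s (x + t • h) - s x‖ ≤ L * (t * ‖h‖) := by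
      have := hs.norm_sub_le (x + t • h) x
      rwa [add_sub_cancel_left, norm_smul, Real.norm_of_nonneg ht.1.le] at this
    have h3 := mul_le_mul_of_nonneg_right h2 (norm_nonneg h)
    nlinarith
  have := hanti (left_mem_Icc.2 zero_le_one) (right_mem_Icc.2 zero_le_one) zero_le_one
  simp only [f, one_smul, zero_smul, add_zero] at this
  linarith

theorem abs_sub_le_of_lipschitz_gradient (hV : ∀ x, HasGradientAt V (s x) x)
    (hs : LipschitzWith L s) (x h : E) :
    |V (x + h) - V x - ⟪s x, h⟫_ℝ| ≤ L / 2 * ‖h‖ ^ 2 := by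
  have h1 := le_add_of_lipschitz_gradient hV hs x h
  have h2 := le_add_of_lipschitz_gradient (V := fun x => -V x) (s := fun x => -s x)
    (fun x => by
      rw [hasGradientAt_iff_hasFDerivAt, map_neg]
      exact (hV x).hasFDerivAt.neg) hs.neg x h
  rw [inner_neg_left] at h2
  rw [abs_le]
  constructor <;> linarith

variable [MeasurableSpace E] [BorelSpace E]

variable (V) in
/-- The measure with density `exp V`. -/
def gibbs : Measure E := volume.withDensity fun x => ENNReal.ofReal (Real.exp (V x))

/-- The score of a log-smooth density is sub-Gaussian. -/
theorem integrable_exp_inner_score [IsProbabilityMeasure (gibbs V)]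
    (hV : ∀ x, HasGradientAt V (s x) x) (hs : LipschitzWith L s) (v : E) :
    Integrable (fun x => Real.exp ⟪s x, v⟫_ℝ) (gibbs V) := by
  have hVm := (continuous_of_hasGradientAt hV).measurable
  have hsm : Measurable fun x => Real.exp ⟪s x, v⟫_ℝ :=
    ((hs.continuous.inner continuous_const).measurable).exp
  refine ⟨hsm.aestronglyMeasurable, ?_⟩
  rw [hasFiniteIntegral_iff_ofReal (Eventually.of_forall fun x => (Real.exp_pos _).le)]
  rw [gibbs, lintegral_withDensity_eq_lintegral_mul _ hVm.exp.ennreal_ofReal hsm.ennreal_ofReal]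
  -- The exponential tilt is absorbed by a translation, V(x) + ⟪s x, v⟫ ≤ V(x + v) + (L/2)‖v‖², and
  -- Lebesgue measure is translation invariant.
  calc ∫⁻ x, ENNReal.ofReal (Real.exp (V x)) * ENNReal.ofReal (Real.exp ⟪s x, v⟫_ℝ)
      ≤ ∫⁻ x, ENNReal.ofReal (Real.exp (L / 2 * ‖v‖ ^ 2)) *
          ENNReal.ofReal (Real.exp (V (x + v))) := by
        refine lintegral_mono fun x => ?_
        rw [← ENNReal.ofReal_mul (Real.exp_pos _).le, ← ENNReal.ofReal_mul (Real.exp_pos _).le,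
          ← Real.exp_add, ← Real.exp_add]
        refine ENNReal.ofReal_le_ofReal (Real.exp_le_exp.2 ?_)
        have := (abs_le.1 (abs_sub_le_of_lipschitz_gradient hV hs x v)).1
        linarith
    _ = ENNReal.ofReal (Real.exp (L / 2 * ‖v‖ ^ 2)) * gibbs V univ := by
        rw [lintegral_const_mul' _ _ ENNReal.ofReal_ne_top,
          lintegral_add_right_eq_self (fun x => ENNReal.ofReal (Real.exp (V x))), gibbs,
          withDensity_apply _ MeasurableSet.univ, Measure.restrict_univ]
    _ < ∞ := by simp

/-- Each coordinate of the score has exponential moments under the target, and finite relative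
entropy transfers integrability to Q. -/
theorem integrable_norm_score [IsProbabilityMeasure (gibbs V)]
    (hV : ∀ x, HasGradientAt V (s x) x) (hs : LipschitzWith L s) {Q : Measure E}
    [IsProbabilityMeasure Q] (hQ : InformationTheory.klDiv Q (gibbs V) ≠ ∞) :
    Integrable (fun x => ‖s x‖) Q := by
  let b := stdOrthonormalBasis ℝ E
  have h1 : ∀ i, Integrable (fun x => ⟪s x, b i⟫_ℝ) Q := by
    intro i
    have hm : Measurable fun x => ⟪s x, b i⟫_ℝ :=
      (hs.continuous.inner continuous_const).measurable
    refine integrable_of_klDiv_ne_top hQ hm ?_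
    refine ((integrable_exp_inner_score hV hs (b i)).add
      (integrable_exp_inner_score hV hs (-b i))).mono'
      (continuous_abs.measurable.comp hm).exp.aestronglyMeasurable
      (Eventually.of_forall fun x => ?_)
    rw [Real.norm_of_nonneg (Real.exp_pos _).le, Pi.add_apply, inner_neg_right]
    rcases abs_cases ⟪s x, b i⟫_ℝ with h | h
    · rw [h.1]
      linarith [Real.exp_pos (-⟪s x, b i⟫_ℝ)]
    · rw [h.1]
      linarith [Real.exp_pos ⟪s x, b i⟫_ℝ]
  refine (integrable_finsetSum Finset.univ fun i _ => (h1 i).norm).mono'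
    hs.continuous.norm.aestronglyMeasurable (Eventually.of_forall fun x => ?_)
  rw [norm_norm]
  calc ‖s x‖ = ‖∑ i, ⟪b i, s x⟫_ℝ • b i‖ := by rw [b.sum_repr']
    _ ≤ ∑ i, ‖⟪b i, s x⟫_ℝ • b i‖ := norm_sum_le _ _
    _ = ∑ i, ‖⟪s x, b i⟫_ℝ‖ := Finset.sum_congr rfl fun i _ => by
      rw [norm_smul, b.norm_eq_one, mul_one, real_inner_comm]

/-- The one-step decrease of the Kullback-Leibler divergence to a log-smooth density under a
perturbation of the identity. -/
theorem klDiv_map_id_add_le [IsProbabilityMeasure (gibbs V)]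
    (hV : ∀ x, HasGradientAt V (s x) x) (hs : LipschitzWith L s) {Q : Measure E}
    [IsProbabilityMeasure Q] (hQ : InformationTheory.klDiv Q (gibbs V) ≠ ∞) {W : E → E}
    {C₁ C₂ : ℝ} (hW : Differentiable ℝ W)
    (hWc : ∀ x v, |⟪fderiv ℝ W x v, v⟫_ℝ| ≤ 1 / 4 * ‖v‖ ^ 2) (hC₁ : ∀ x, ‖W x‖ ^ 2 ≤ C₁)
    (hC₂ : ∀ x, hsSq (fderiv ℝ W x) ≤ C₂)
    (hint : Integrable (fun x => ⟪s x, W x⟫_ℝ + opTrace (fderiv ℝ W x)) Q) :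
    InformationTheory.klDiv (Q.map fun x => x + W x) (gibbs V) ≠ ∞ ∧
      (InformationTheory.klDiv (Q.map fun x => x + W x) (gibbs V)).toReal
        - (InformationTheory.klDiv Q (gibbs V)).toReal
      ≤ -(∫ x, ⟪s x, W x⟫_ℝ + opTrace (fderiv ℝ W x) ∂Q) + (L / 2 * C₁ + 2 * C₂) := by
  let φ : E → E := fun x => x + W x
  have hVc := continuous_of_hasGradientAt hV
  have hφ : ∀ x, HasFDerivAt φ (1 + fderiv ℝ W x) x := fun x =>
    (hasFDerivAt_id x).add (hW x).hasFDerivAt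
  have hφc : ∀ x v, 3 / 4 * ‖v‖ ^ 2 ≤ ⟪(1 + fderiv ℝ W x) v, v⟫_ℝ := by
    intro x v
    have := (abs_le.1 (hWc x v)).1
    rw [add_apply, inner_add_left, one_apply_eq_self, real_inner_self_eq_norm_sq]
    linarith
  obtain ⟨G, hG, hGφ, hφG⟩ := exists_continuous_inverse_of_coercive (by norm_num) hφ hφc
  have hφcont : Continuous φ := continuous_iff_continuousAt.2 fun x => (hφ x).continuousAt
  -- The density, relative to exp V, of the measure that φ pushes forward to exp V.
  let r : E → ℝ := fun x => Real.exp (V (φ x) - V x) * |(1 + fderiv ℝ W x).det|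
  have hdet : ∀ x, (1 + fderiv ℝ W x).det ≠ 0 := fun x => (log_abs_det_one_add_bounds (hWc x)).1
  have hrpos : ∀ x, 0 < r x := fun x => mul_pos (Real.exp_pos _) (abs_pos.2 (hdet x))
  have hrm : Measurable r := by
    have h1 : Measurable fun x => (1 + fderiv ℝ W x).det :=
      (contDiff_det.continuous.comp (continuous_const.add continuous_id)).measurable.comp
        (measurable_fderiv ℝ W)
    exact (((hVc.comp hφcont).sub hVc).measurable.exp).mul (continuous_abs.measurable.comp h1)
  have hmap : ((gibbs V).withDensity fun x => ENNReal.ofReal (r x)).map φ = gibbs V := by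
    have h1 := map_withDensity_abs_det hφ hGφ.injective fun y => ENNReal.ofReal (Real.exp (V y))
    rw [hφG.surjective.range_eq, Measure.restrict_univ] at h1
    rw [gibbs, ← withDensity_mul _ hVc.measurable.exp.ennreal_ofReal hrm.ennreal_ofReal]
    rw [← h1]
    congr 2
    ext x
    rw [Pi.mul_apply, ← ENNReal.ofReal_mul (Real.exp_pos _).le,
      ← ENNReal.ofReal_mul (abs_nonneg _)]
    congr 1
    simp only [r]
    rw [← mul_assoc, ← Real.exp_add, mul_comm, add_sub_cancel]
  have hprob : IsProbabilityMeasure ((gibbs V).withDensity fun x => ENNReal.ofReal (r x)) := by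
    constructor
    have h1 : ((gibbs V).withDensity fun x => ENNReal.ofReal (r x)).map φ univ = 1 := by
      rw [hmap]; exact measure_univ
    rwa [Measure.map_apply hφcont.measurable MeasurableSet.univ, preimage_univ] at h1
  -- The lower bound gives the descent; both sides are used for the integrability of log r.
  have hbound : ∀ x, |Real.log (r x) - (⟪s x, W x⟫_ℝ + opTrace (fderiv ℝ W x))|
      ≤ L / 2 * C₁ + 2 * C₂ := by
    intro x
    have h1 := abs_le.1 (abs_sub_le_of_lipschitz_gradient hV hs x (W x))
    obtain ⟨-, h2, h3⟩ := log_abs_det_one_add_bounds (hWc x)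
    have h4 : (L : ℝ) / 2 * ‖W x‖ ^ 2 ≤ L / 2 * C₁ :=
      mul_le_mul_of_nonneg_left (hC₁ x) (by positivity)
    have h5 := hC₂ x
    have h6 := hsSq_nonneg (fderiv ℝ W x)
    simp only [r]
    rw [Real.log_mul (Real.exp_pos _).ne' (abs_ne_zero.2 (hdet x)), Real.log_exp, abs_le]
    simp only [φ]
    constructor <;> linarith [h1.1, h1.2]
  have hlogint : Integrable (fun x => Real.log (r x)) Q := by
    have h1 : Integrable (fun x => Real.log (r x)
        - (⟪s x, W x⟫_ℝ + opTrace (fderiv ℝ W x))) Q :=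
      (integrable_const (L / 2 * C₁ + 2 * C₂)).mono'
        (hrm.log.aestronglyMeasurable.sub hint.aestronglyMeasurable)
        (Eventually.of_forall hbound)
    refine (h1.add hint).congr (Eventually.of_forall fun x => ?_)
    simp
  obtain ⟨h1, h2⟩ := klDiv_withDensity_right hrm hrpos hprob hQ hlogint
  -- Undo the bijection φ in both arguments: KL(φ_*Q ‖ exp V) = KL(Q ‖ r exp V).
  have h3 := klDiv_map_of_leftInverse (μ := Q)
    (ν := (gibbs V).withDensity fun x => ENNReal.ofReal (r x)) hφcont.measurable hG.measurable hGφ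
  rw [hmap] at h3
  change InformationTheory.klDiv (Q.map φ) (gibbs V) ≠ ∞ ∧
    (InformationTheory.klDiv (Q.map φ) (gibbs V)).toReal - _ ≤ _
  rw [h3]
  refine ⟨h1, ?_⟩
  rw [h2]
  have h4 : ∫ x, (⟪s x, W x⟫_ℝ + opTrace (fderiv ℝ W x)) - (L / 2 * C₁ + 2 * C₂) ∂Q
      ≤ ∫ x, Real.log (r x) ∂Q := by
    refine integral_mono (hint.sub (integrable_const _)) hlogint fun x => ?_
    have := (abs_le.1 (hbound x)).1
    simp only
    linarith
  rw [integral_sub hint (integrable_const _), integral_const] at h4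
  simp only [probReal_univ, one_smul] at h4
  linarith

end SmoothDensity

end

section

theorem continuous_opTrace {E : Type*} [NormedAddCommGroup E] [InnerProductSpace ℝ E]
    [FiniteDimensional ℝ E] : Continuous fun F : E →L[ℝ] E => opTrace F := by
  have h : (fun F : E →L[ℝ] E => opTrace F)
      = fun F => ∑ i, ⟪F (stdOrthonormalBasis ℝ E i), stdOrthonormalBasis ℝ E i⟫_ℝ :=
    funext fun F => opTrace_eq_sum F _
  rw [h]
  fun_prop

/-! ### Transfer of the target to the dual coordinates. -/

variable {d : ℕ} {Θ : Set (EuclideanSpace ℝ (Fin d))} {p ψ : EuclideanSpace ℝ (Fin d) → ℝ}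
  {α : ℝ}

theorem measurable_gradient {E : Type*} [NormedAddCommGroup E] [InnerProductSpace ℝ E]
    [CompleteSpace E] [MeasurableSpace E] [BorelSpace E] (f : E → ℝ) :
    Measurable (gradient f) :=
  (InnerProductSpace.toDual ℝ E).symm.continuous.measurable.comp (measurable_fderiv ℝ f)

theorem steinOp_congr {g g' : EuclideanSpace ℝ (Fin d) → EuclideanSpace ℝ (Fin d)}
    {θ : EuclideanSpace ℝ (Fin d)} (h : g =ᶠ[𝓝 θ] g') : steinOp p ψ g θ = steinOp p ψ g' θ := by
  have h1 : (fun x => invHess ψ x (g x)) =ᶠ[𝓝 θ] fun x => invHess ψ x (g' x) :=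
    h.mono fun x hx => by simp only [hx]
  rw [steinOp, steinOp, h.eq_of_nhds, divergence, divergence, h1.fderiv_eq]

/-- The frontier of a convex set is Lebesgue null, so the values of p there do not matter. -/
theorem target_eq_restrict_interior (hΘ : Convex ℝ Θ) :
    target Θ p = (volume.restrict (interior Θ)).withDensity fun θ => ENNReal.ofReal (p θ) := by
  rw [target, ← Measure.restrict_congr_set
    (interior_ae_eq_of_null_frontier (hΘ.addHaar_frontier volume))]

theorem interior_nonempty_of_target (hΘ : Convex ℝ Θ)
    (hp : IsProbabilityMeasure (target Θ p)) : (interior Θ).Nonempty := by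
  by_contra h
  rw [not_nonempty_iff_eq_empty] at h
  have h1 : target Θ p univ = 1 := measure_univ
  rw [target_eq_restrict_interior hΘ, h] at h1
  simp at h1

theorem target_compl_interior (hΘ : Convex ℝ Θ) :
    target Θ p (interior Θ)ᶜ = 0 := by
  rw [target_eq_restrict_interior hΘ]
  refine withDensity_absolutelyContinuous _ _ ?_
  rw [Measure.restrict_apply isOpen_interior.measurableSet.compl, compl_inter_self, measure_empty]

/-- The assumptions on the target density `p` and the mirror function `ψ`. -/
structure IsMirroredTarget (Θ : Set (EuclideanSpace ℝ (Fin d)))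
    (p ψ : EuclideanSpace ℝ (Fin d) → ℝ) (α : ℝ) : Prop extends IsMirror Θ ψ α where
  prob : IsProbabilityMeasure (target Θ p)
  density_pos : ∀ θ ∈ interior Θ, 0 < p θ
  density_diff : DifferentiableOn ℝ p (interior Θ)
  invHess_diff : DifferentiableOn ℝ (invHess ψ) (interior Θ)

/-- The logarithm of the mirrored density. -/
def logMirrored (Θ : Set (EuclideanSpace ℝ (Fin d))) (p ψ : EuclideanSpace ℝ (Fin d) → ℝ)
    (η : EuclideanSpace ℝ (Fin d)) : ℝ :=
  Real.log (mirroredDensity Θ p ψ η)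

namespace IsMirror

theorem range_gradient_conjugate (h : IsMirror Θ ψ α) :
    range (gradient (conjugate Θ ψ)) = interior Θ := by
  refine Subset.antisymm (range_subset_iff.2 h.gradient_conjugate_mem) fun θ hθ => ?_
  exact ⟨gradient ψ θ, h.gradient_conjugate_gradient hθ⟩

theorem injective_gradient_conjugate (h : IsMirror Θ ψ α) :
    Function.Injective (gradient (conjugate Θ ψ)) :=
  Function.LeftInverse.injective h.gradient_gradient_conjugate

theorem measurableEmbedding_gradient_conjugate (h : IsMirror Θ ψ α) :
    MeasurableEmbedding (gradient (conjugate Θ ψ)) :=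
  h.continuous_gradient_conjugate.measurableEmbedding h.injective_gradient_conjugate

theorem map_gradient_conjugate_map_gradient (h : IsMirror Θ ψ α)
    {q : Measure (EuclideanSpace ℝ (Fin d))} (hq : ∀ᵐ θ ∂q, θ ∈ interior Θ) :
    (q.map (gradient ψ)).map (gradient (conjugate Θ ψ)) = q := by
  rw [Measure.map_map h.continuous_gradient_conjugate.measurable (measurable_gradient ψ)]
  conv_rhs => rw [← Measure.map_id (μ := q)]
  exact Measure.map_congr (hq.mono fun θ hθ => h.gradient_conjugate_gradient hθ)

end IsMirror

namespace IsMirroredTarget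

theorem hasGradientAt_logMirrored (h : IsMirroredTarget Θ p ψ α) (η : EuclideanSpace ℝ (Fin d)) :
    HasGradientAt (logMirrored Θ p ψ) (gradient (logMirrored Θ p ψ) η) η :=
  h.hasGradientAt_log_mirroredDensity h.density_pos h.density_diff h.invHess_diff η

/-- Change of variables along ∇ψ*: the factor |det ∇²ψ*| in p_H is its Jacobian. -/
theorem target_eq_map_gibbs (h : IsMirroredTarget Θ p ψ α) :
    target Θ p = (gibbs (logMirrored Θ p ψ)).map (gradient (conjugate Θ ψ)) := by
  have h1 := map_withDensity_abs_det h.hasFDerivAt_gradient_conjugate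
    h.injective_gradient_conjugate fun θ => ENNReal.ofReal (p θ)
  rw [h.range_gradient_conjugate] at h1
  rw [target_eq_restrict_interior h.convex, ← h1, gibbs]
  congr 2
  ext η
  rw [logMirrored, Real.exp_log (h.mirroredDensity_pos h.density_pos η), h.mirroredDensity_eq,
    ← ENNReal.ofReal_mul (abs_nonneg _), mul_comm]

theorem isProbabilityMeasure_gibbs (h : IsMirroredTarget Θ p ψ α) :
    IsProbabilityMeasure (gibbs (logMirrored Θ p ψ)) := by
  constructor
  have h1 : target Θ p univ = 1 := h.prob.measure_univ
  rwa [h.target_eq_map_gibbs, Measure.map_apply h.continuous_gradient_conjugate.measurable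
    MeasurableSet.univ, preimage_univ] at h1

theorem klDiv_map_target (h : IsMirroredTarget Θ p ψ α) (Q : Measure (EuclideanSpace ℝ (Fin d)))
    [IsFiniteMeasure Q] :
    InformationTheory.klDiv (Q.map (gradient (conjugate Θ ψ))) (target Θ p)
      = InformationTheory.klDiv Q (gibbs (logMirrored Θ p ψ)) := by
  have := h.isProbabilityMeasure_gibbs
  rw [h.target_eq_map_gibbs]
  exact klDiv_map_of_leftInverse h.continuous_gradient_conjugate.measurable
    (measurable_gradient ψ) h.gradient_gradient_conjugate

theorem ae_mem_interior (h : IsMirroredTarget Θ p ψ α) {q : Measure (EuclideanSpace ℝ (Fin d))}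
    (hq : InformationTheory.klDiv q (target Θ p) ≠ ∞) : ∀ᵐ θ ∂q, θ ∈ interior Θ :=
  (InformationTheory.klDiv_ne_top_iff.1 hq).1 (target_compl_interior h.convex)

end IsMirroredTarget

/-! ### The Stein functional on the RKHS and the update direction. -/

section Kernel

variable {H : Type*} [NormedAddCommGroup H] [InnerProductSpace ℝ H]
  [RKHS ℝ H (interior Θ) (EuclideanSpace ℝ (Fin d))]
  {K : EuclideanSpace ℝ (Fin d) → EuclideanSpace ℝ (Fin d) →
      (EuclideanSpace ℝ (Fin d) →L[ℝ] EuclideanSpace ℝ (Fin d))}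

/-- The vector field `f` in the mirrored coordinates. -/
def mirroredField (ψ : EuclideanSpace ℝ (Fin d) → ℝ) (f : H) (η : EuclideanSpace ℝ (Fin d)) :
    EuclideanSpace ℝ (Fin d) :=
  toField f (gradient (conjugate Θ ψ) η)

theorem kappa₁_nonneg : 0 ≤ kappa₁ (interior Θ) K :=
  Real.sSup_nonneg (by rintro _ ⟨θ, -, rfl⟩; exact norm_nonneg _)

theorem kappa₂_nonneg : 0 ≤ kappa₂ (interior Θ) K :=
  Finset.sum_nonneg fun i _ => Real.sSup_nonneg (by rintro _ ⟨θ, -, rfl⟩; exact norm_nonneg _)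

theorem IsMirror.mirroredField_apply (h : IsMirror Θ ψ α) (f : H)
    (η : EuclideanSpace ℝ (Fin d)) :
    mirroredField ψ f η = f ⟨gradient (conjugate Θ ψ) η, h.gradient_conjugate_mem η⟩ :=
  toField_apply f _

theorem IsMirror.mirroredField_add (h : IsMirror Θ ψ α) (f g : H) :
    mirroredField ψ (f + g) = mirroredField ψ f + mirroredField ψ g := by
  ext1 η
  rw [Pi.add_apply, h.mirroredField_apply, h.mirroredField_apply, h.mirroredField_apply,
    RKHS.coe_add, Pi.add_apply]

theorem IsMirror.mirroredField_smul (h : IsMirror Θ ψ α) (c : ℝ) (f : H) :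
    mirroredField ψ (c • f) = c • mirroredField ψ f := by
  ext1 η
  rw [Pi.smul_apply, h.mirroredField_apply, h.mirroredField_apply, RKHS.coe_smul, Pi.smul_apply]

/-- Cauchy-Schwarz, with equality at g/‖g‖; for g = 0 the convention 0⁻¹ = 0 makes the witness zero.
-/
theorem isGreatest_steinValues {q : Measure (EuclideanSpace ℝ (Fin d))} {g : H}
    (hg : ∀ f : H, ∫ θ, steinOp p ψ (toField f) θ ∂q = ⟪g, f⟫_ℝ) :
    IsGreatest (steinValues H p ψ q) ‖g‖ := by
  refine ⟨?_, ?_⟩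
  · refine ⟨‖g‖⁻¹ • g, ?_, ?_⟩
    · rw [norm_smul, norm_inv, norm_norm]
      exact inv_mul_le_one
    · rw [hg, real_inner_smul_right, real_inner_self_eq_norm_sq, sq]
      rcases eq_or_ne ‖g‖ 0 with h | h
      · rw [h]; simp
      · rw [inv_mul_cancel_left₀ h]
  · rintro _ ⟨f, hf, rfl⟩
    rw [hg]
    exact (real_inner_le_norm g f).trans (mul_le_of_le_one_right (norm_nonneg _) hf)

variable [CompleteSpace H]

variable (Θ H K) in
/-- The assumptions on the kernel `K` of the space `H`. -/
structure IsBoundedC1Kernel : Prop where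
  kernel_eq : ∀ θ θ' : interior Θ, RKHS.kernel H θ θ' = K θ θ'
  mixedC1 : MixedC1 (interior Θ) K
  bdd : BddAbove ((fun θ => ‖K θ θ‖) '' interior Θ)
  bdd_mixed : ∀ i, BddAbove ((fun θ => ‖mixedPartial K i i θ θ‖) '' interior Θ)

namespace IsBoundedC1Kernel

theorem hasFDerivAt_mirroredField (hK : IsBoundedC1Kernel Θ H K) (h : IsMirror Θ ψ α) (f : H)
    (η : EuclideanSpace ℝ (Fin d)) :
    HasFDerivAt (mirroredField ψ f)
      (fderiv ℝ (toField f) (gradient (conjugate Θ ψ) η) ∘L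
        invHess ψ (gradient (conjugate Θ ψ) η)) η :=
  (differentiableAt_toField h.convex hK.kernel_eq hK.mixedC1 f
    (h.gradient_conjugate_mem η)).hasFDerivAt.comp η (h.hasFDerivAt_gradient_conjugate η)

theorem differentiable_mirroredField (hK : IsBoundedC1Kernel Θ H K) (h : IsMirror Θ ψ α)
    (f : H) : Differentiable ℝ (mirroredField ψ f) := fun η =>
  (hK.hasFDerivAt_mirroredField h f η).differentiableAt

theorem norm_mirroredField_sq_le (hK : IsBoundedC1Kernel Θ H K) (h : IsMirror Θ ψ α) (f : H)
    (η : EuclideanSpace ℝ (Fin d)) :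
    ‖mirroredField ψ f η‖ ^ 2 ≤ kappa₁ (interior Θ) K * ‖f‖ ^ 2 := by
  have hθ := h.gradient_conjugate_mem η
  have h1 := RKHS.norm_apply_le f ⟨_, hθ⟩
  rw [← h.mirroredField_apply, hK.kernel_eq] at h1
  have h2 := pow_le_pow_left₀ (norm_nonneg _) h1 2
  rw [mul_pow, Real.sq_sqrt (norm_nonneg (K _ _)), mul_comm] at h2
  exact h2.trans (mul_le_mul_of_nonneg_right (le_csSup hK.bdd ⟨_, hθ, rfl⟩) (by positivity))

/-- The squared partial derivatives of f sum to at most κ₂‖f‖², and the chain rule contributes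
∇²ψ⁻¹, of norm at most α⁻¹. -/
theorem hsSq_fderiv_mirroredField_le (hK : IsBoundedC1Kernel Θ H K) (h : IsMirror Θ ψ α) (f : H)
    (η : EuclideanSpace ℝ (Fin d)) :
    hsSq (fderiv ℝ (mirroredField ψ f) η)
      ≤ kappa₂ (interior Θ) K / α ^ 2 * ‖f‖ ^ 2 := by
  have hθ := h.gradient_conjugate_mem η
  rw [(hK.hasFDerivAt_mirroredField h f η).fderiv]
  set θ := gradient (conjugate Θ ψ) η
  have h1 : hsSq (fderiv ℝ (toField f) θ) ≤ kappa₂ (interior Θ) K * ‖f‖ ^ 2 := by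
    rw [hsSq_eq_sum _ (EuclideanSpace.basisFun (Fin d) ℝ), kappa₂, Finset.sum_mul]
    refine Finset.sum_le_sum fun j _ => ?_
    rw [EuclideanSpace.basisFun_apply]
    exact (norm_fderiv_toField_le h.convex hK.kernel_eq hK.mixedC1 f hθ j).trans
      (mul_le_mul_of_nonneg_right (le_csSup (hK.bdd_mixed j) ⟨_, hθ, rfl⟩) (by positivity))
  calc _ ≤ ‖invHess ψ θ‖ ^ 2 * hsSq (fderiv ℝ (toField f) θ) := hsSq_comp_le _ _
    _ ≤ α⁻¹ ^ 2 * (kappa₂ (interior Θ) K * ‖f‖ ^ 2) := by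
      refine mul_le_mul (pow_le_pow_left₀ (norm_nonneg _) (h.norm_invHess_le hθ) 2) h1
        (hsSq_nonneg _) (by positivity)
    _ = _ := by rw [inv_pow]; ring

theorem steinOp_toField (hK : IsBoundedC1Kernel Θ H K) (h : IsMirroredTarget Θ p ψ α) (f : H)
    (η : EuclideanSpace ℝ (Fin d)) :
    steinOp p ψ (toField f) (gradient (conjugate Θ ψ) η)
      = ⟪gradient (logMirrored Θ p ψ) η, mirroredField ψ f η⟫_ℝ
        + opTrace (fderiv ℝ (mirroredField ψ f) η) := by
  rw [(hK.hasFDerivAt_mirroredField h.toIsMirror f η).fderiv]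
  exact h.steinOp_eq h.density_pos h.density_diff h.invHess_diff η
    (differentiableAt_toField h.convex hK.kernel_eq hK.mixedC1 f (h.gradient_conjugate_mem η))

variable {L : ℝ≥0} {q : Measure (EuclideanSpace ℝ (Fin d))}

/-- A bound linear in ‖f‖ whose coefficient is Q-integrable yields both integrability and continuity
of the Stein functional. The factor d comes from (tr F)² ≤ d ‖F‖² in Hilbert-Schmidt norm. -/
theorem abs_steinOp_toField_le (hK : IsBoundedC1Kernel Θ H K) (h : IsMirroredTarget Θ p ψ α)
    (f : H) (η : EuclideanSpace ℝ (Fin d)) :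
    |⟪gradient (logMirrored Θ p ψ) η, mirroredField ψ f η⟫_ℝ
        + opTrace (fderiv ℝ (mirroredField ψ f) η)| ≤
      (‖gradient (logMirrored Θ p ψ) η‖ * √(kappa₁ (interior Θ) K)
        + √(d * (kappa₂ (interior Θ) K / α ^ 2))) * ‖f‖ := by
  have h1 : ‖mirroredField ψ f η‖ ≤ √(kappa₁ (interior Θ) K) * ‖f‖ := by
    refine (sq_le_sq₀ (by positivity) (by positivity)).1 ?_
    rw [mul_pow, Real.sq_sqrt kappa₁_nonneg]
    exact hK.norm_mirroredField_sq_le h.toIsMirror f η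
  have h2 : |opTrace (fderiv ℝ (mirroredField ψ f) η)|
      ≤ √(d * (kappa₂ (interior Θ) K / α ^ 2)) * ‖f‖ := by
    have hnn : 0 ≤ (d : ℝ) * (kappa₂ (interior Θ) K / α ^ 2) :=
      mul_nonneg (Nat.cast_nonneg d) (div_nonneg kappa₂_nonneg (sq_nonneg α))
    refine abs_le_of_sq_le_sq ?_ (by positivity)
    rw [mul_pow, Real.sq_sqrt hnn]
    refine (sq_opTrace_le _).trans ?_
    rw [finrank_euclideanSpace_fin, mul_assoc]
    exact mul_le_mul_of_nonneg_left (hK.hsSq_fderiv_mirroredField_le h.toIsMirror f η)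
      (Nat.cast_nonneg d)
  have h3 := abs_real_inner_le_norm (gradient (logMirrored Θ p ψ) η) (mirroredField ψ f η)
  have h4 := mul_le_mul_of_nonneg_left h1 (norm_nonneg (gradient (logMirrored Θ p ψ) η))
  refine (abs_add_le _ _).trans ?_
  linarith

theorem integrable_mirrored (hK : IsBoundedC1Kernel Θ H K) (h : IsMirroredTarget Θ p ψ α)
    (hL : LipschitzWith L (gradient (logMirrored Θ p ψ)))
    {Q : Measure (EuclideanSpace ℝ (Fin d))} [IsProbabilityMeasure Q]
    (hQ : InformationTheory.klDiv Q (gibbs (logMirrored Θ p ψ)) ≠ ∞) (f : H) :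
    Integrable (fun η => ⟪gradient (logMirrored Θ p ψ) η, mirroredField ψ f η⟫_ℝ
        + opTrace (fderiv ℝ (mirroredField ψ f) η)) Q := by
  have := h.isProbabilityMeasure_gibbs
  have h1 := integrable_norm_score h.hasGradientAt_logMirrored hL hQ
  refine (((h1.mul_const (√(kappa₁ (interior Θ) K))).add (integrable_const
    (√(d * (kappa₂ (interior Θ) K / α ^ 2))))).mul_const ‖f‖).mono' ?_
    (Eventually.of_forall fun η => hK.abs_steinOp_toField_le h f η)
  refine Measurable.aestronglyMeasurable (Measurable.add ?_ ?_)
  · exact (hL.continuous.inner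
      (hK.differentiable_mirroredField h.toIsMirror f).continuous).measurable
  · exact continuous_opTrace.measurable.comp (measurable_fderiv ℝ _)

/-- The functional `f ↦ E_q[M_{p,ψ} f]` is represented by an element of `H`. -/
theorem exists_representer (hK : IsBoundedC1Kernel Θ H K) (h : IsMirroredTarget Θ p ψ α)
    (hL : LipschitzWith L (gradient (logMirrored Θ p ψ)))
    {Q : Measure (EuclideanSpace ℝ (Fin d))} [IsProbabilityMeasure Q]
    (hQ : InformationTheory.klDiv Q (gibbs (logMirrored Θ p ψ)) ≠ ∞) :
    ∃ g : H, ∀ f : H, ∫ η, ⟪gradient (logMirrored Θ p ψ) η, mirroredField ψ f η⟫_ℝ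
        + opTrace (fderiv ℝ (mirroredField ψ f) η) ∂Q = ⟪g, f⟫_ℝ := by
  have := h.isProbabilityMeasure_gibbs
  have hint := hK.integrable_mirrored h hL hQ
  have hdiff := hK.differentiable_mirroredField h.toIsMirror
  let Λ₀ : H →ₗ[ℝ] ℝ :=
    { toFun := fun f => ∫ η, ⟪gradient (logMirrored Θ p ψ) η, mirroredField ψ f η⟫_ℝ
        + opTrace (fderiv ℝ (mirroredField ψ f) η) ∂Q
      map_add' := fun f g => by
        rw [← integral_add (hint f) (hint g)]
        refine integral_congr_ae (Eventually.of_forall fun η => ?_)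
        simp only
        rw [h.toIsMirror.mirroredField_add, fderiv_add (hdiff f η) (hdiff g η), Pi.add_apply,
          inner_add_right, opTrace_add]
        ring
      map_smul' := fun c f => by
        rw [RingHom.id_apply, smul_eq_mul, ← integral_const_mul]
        refine integral_congr_ae (Eventually.of_forall fun η => ?_)
        simp only
        rw [h.toIsMirror.mirroredField_smul, fderiv_const_smul (hdiff f η), Pi.smul_apply,
          real_inner_smul_right, opTrace_smul]
        ring }
  let Λ : H →L[ℝ] ℝ := Λ₀.mkContinuous
    (∫ η, ‖gradient (logMirrored Θ p ψ) η‖ * √(kappa₁ (interior Θ) K)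
        + √(d * (kappa₂ (interior Θ) K / α ^ 2)) ∂Q) fun f => by
    have h1 := integrable_norm_score h.hasGradientAt_logMirrored hL hQ
    rw [← integral_mul_const]
    exact norm_integral_le_of_norm_le (((h1.mul_const _).add (integrable_const _)).mul_const _)
      (Eventually.of_forall fun η => hK.abs_steinOp_toField_le h f η)
  refine ⟨(InnerProductSpace.toDual ℝ H).symm Λ, fun f => ?_⟩
  rw [InnerProductSpace.toDual_symm_apply]
  rfl

theorem adjoint_kernel (hK : IsBoundedC1Kernel Θ H K) {x y : EuclideanSpace ℝ (Fin d)}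
    (hx : x ∈ interior Θ) (hy : y ∈ interior Θ) :
    ContinuousLinearMap.adjoint (K y x) = K x y := by
  have h1 := hK.kernel_eq ⟨x, hx⟩ ⟨y, hy⟩
  have h2 := hK.kernel_eq ⟨y, hy⟩ ⟨x, hx⟩
  rw [← h1, ← h2, RKHS.kernel_apply, RKHS.kernel_apply, ContinuousLinearMap.adjoint_comp,
    ContinuousLinearMap.adjoint_adjoint]

/-- By the symmetry K(θ', x)* = K(x, θ') each row is a kernel section in H. The two fields agree
only on int Θ, which suffices because the Stein operator is local and q lives there. -/
theorem direction_apply (hK : IsBoundedC1Kernel Θ H K) (hq : ∀ᵐ θ ∂q, θ ∈ interior Θ)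
    {θ' : EuclideanSpace ℝ (Fin d)} (hθ' : θ' ∈ interior Θ) (i : Fin d) :
    direction p ψ K q θ' i = ∫ θ, steinOp p ψ (toField (feature H (stdVec i) θ')) θ ∂q := by
  refine integral_congr_ae (hq.mono fun θ hθ => steinOp_congr ?_)
  filter_upwards [isOpen_interior.mem_nhds hθ] with x hx
  rw [hK.adjoint_kernel hx hθ', feature_apply _ hθ', toField_apply _ hx, RKHS.kerFun_apply,
    hK.kernel_eq]

theorem direction_eq_toField (hK : IsBoundedC1Kernel Θ H K) (hq : ∀ᵐ θ ∂q, θ ∈ interior Θ)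
    {g : H} (hg : ∀ f : H, ∫ θ, steinOp p ψ (toField f) θ ∂q = ⟪g, f⟫_ℝ)
    {θ' : EuclideanSpace ℝ (Fin d)} (hθ' : θ' ∈ interior Θ) :
    direction p ψ K q θ' = toField g θ' := by
  ext i
  rw [hK.direction_apply hq hθ', hg, inner_feature g _ hθ', stdVec, real_inner_comm,
    EuclideanSpace.inner_single_left]
  simp

end IsBoundedC1Kernel

/-- The bound on the step size makes the update a small perturbation of the identity in the
mirrored coordinates. -/
theorem abs_inner_fderiv_le_of_step {h : IsMirror Θ ψ α} (hK : IsBoundedC1Kernel Θ H K) {g : H}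
    {v : EuclideanSpace ℝ (Fin d) → EuclideanSpace ℝ (Fin d)}
    (hv : ∀ θ ∈ interior Θ, v θ = toField g θ) {ε : ℝ} (hε : 0 < ε)
    (hstep : ENNReal.ofReal ε < 1 / (2 * ⨆ θ ∈ interior Θ,
      ‖invHess ψ θ ∘L gradField v θ
        + ContinuousLinearMap.adjoint (gradField v θ) ∘L invHess ψ θ‖ₑ))
    (η w : EuclideanSpace ℝ (Fin d)) :
    |⟪fderiv ℝ (ε • mirroredField ψ g) η w, w⟫_ℝ| ≤ 1 / 4 * ‖w‖ ^ 2 := by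
  have hθ := h.gradient_conjugate_mem η
  rw [((hK.hasFDerivAt_mirroredField h g η).const_smul ε).fderiv]
  set θ := gradient (conjugate Θ ψ) η
  set B := fderiv ℝ (toField g) θ ∘L invHess ψ θ with hB
  have hfd : fderiv ℝ v θ = fderiv ℝ (toField g) θ :=
    Filter.EventuallyEq.fderiv_eq ((isOpen_interior.mem_nhds hθ |> fun hU =>
      Filter.mem_of_superset hU hv))
  -- As ∇²ψ⁻¹ is symmetric, the matrix in the step size condition is B + B*, twice the symmetric
  -- part of the derivative in dual coordinates; hence |⟪εBw, w⟫| ≤ (ε/2)‖B + B*‖‖w‖² ≤ ‖w‖²/4.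
  have hsym : invHess ψ θ ∘L gradField v θ
      + ContinuousLinearMap.adjoint (gradField v θ) ∘L invHess ψ θ
      = ContinuousLinearMap.adjoint B + B := by
    rw [gradField, ContinuousLinearMap.adjoint_adjoint, hfd, hB, ContinuousLinearMap.adjoint_comp,
      h.adjoint_invHess hθ]
  have h1 : ‖ContinuousLinearMap.adjoint B + B‖ₑ ≤ ⨆ θ ∈ interior Θ,
      ‖invHess ψ θ ∘L gradField v θ
        + ContinuousLinearMap.adjoint (gradField v θ) ∘L invHess ψ θ‖ₑ := by
    rw [← hsym]
    exact le_iSup₂ (f := fun θ (_ : θ ∈ interior Θ) => ‖invHess ψ θ ∘L gradField v θ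
        + ContinuousLinearMap.adjoint (gradField v θ) ∘L invHess ψ θ‖ₑ) θ hθ
  have h2 : ε * (2 * ‖ContinuousLinearMap.adjoint B + B‖) ≤ 1 := by
    have h3 := (mul_le_mul_right (mul_le_mul_right h1 2) (ENNReal.ofReal ε)).trans
      (ENNReal.mul_le_of_le_div hstep.le)
    have h4 := ENNReal.toReal_mono ENNReal.one_ne_top h3
    rwa [ENNReal.toReal_mul, ENNReal.toReal_mul, ENNReal.toReal_ofReal hε.le, toReal_enorm,
      ENNReal.toReal_ofNat, ENNReal.toReal_one] at h4
  have h3 : 2 * ⟪B w, w⟫_ℝ = ⟪(ContinuousLinearMap.adjoint B + B) w, w⟫_ℝ := by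
    rw [add_apply, inner_add_left, ContinuousLinearMap.adjoint_inner_left,
      real_inner_comm w]
    ring
  have h4 : |2 * ⟪B w, w⟫_ℝ| ≤ ‖ContinuousLinearMap.adjoint B + B‖ * ‖w‖ * ‖w‖ := by
    rw [h3]
    exact (abs_real_inner_le_norm _ _).trans
      (mul_le_mul_of_nonneg_right (ContinuousLinearMap.le_opNorm _ _) (norm_nonneg _))
  rw [abs_mul, abs_two] at h4
  rw [smul_apply, real_inner_smul_left, abs_mul, abs_of_pos hε]
  nlinarith [mul_le_mul_of_nonneg_left h4 hε.le, mul_le_mul_of_nonneg_right h2 (sq_nonneg ‖w‖)]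

theorem IsMirror.update_eq (h : IsMirror Θ ψ α) (hK : IsBoundedC1Kernel Θ H K)
    {q : Measure (EuclideanSpace ℝ (Fin d))} (hq : ∀ᵐ θ ∂q, θ ∈ interior Θ) {g : H}
    (hg : ∀ θ ∈ interior Θ, direction p ψ K q θ = toField g θ) (ε : ℝ) :
    update Θ p ψ K ε q = ((q.map (gradient ψ)).map
      fun η => η + (ε • mirroredField ψ g) η).map (gradient (conjugate Θ ψ)) := by
  have hm : Measurable fun η => η + (ε • mirroredField ψ g) η :=
    (continuous_id.add
      ((hK.differentiable_mirroredField h g).continuous.const_smul ε)).measurable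
  rw [Measure.map_map hm (measurable_gradient ψ),
    Measure.map_map h.continuous_gradient_conjugate.measurable (hm.comp (measurable_gradient ψ)),
    update]
  refine Measure.map_congr (hq.mono fun θ hθ => ?_)
  simp only [Function.comp_apply, Pi.smul_apply, mirroredField]
  rw [hg θ hθ, h.gradient_conjugate_gradient hθ]

end Kernel

end

end MirroredStein

end

/-! ### Descent of KL along the mirrored update. -/

theorem mainTheorem2 {d : ℕ}
    -- the target: a probability density `p`, positive and differentiable on the interior of `Θ`
    (Θ : Set (EuclideanSpace ℝ (Fin d))) (hΘ_closed : IsClosed Θ) (hΘ_convex : Convex ℝ Θ)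
    (p : EuclideanSpace ℝ (Fin d) → ℝ)
    (hp_prob : IsProbabilityMeasure (MirroredStein.target Θ p))
    (hp_pos : ∀ θ ∈ interior Θ, 0 < p θ)
    (hp_diff : DifferentiableOn ℝ p (interior Θ))
    -- the mirror function
    (ψ : EuclideanSpace ℝ (Fin d) → ℝ) (α : ℝ) (hα : 0 < α)
    (hψ_convex : StrongConvexOn (interior Θ) α ψ)
    (hψ_smooth : MirroredStein.EssentiallySmooth Θ ψ)
    (hψ_C2 : ContDiffOn ℝ 2 ψ (interior Θ))
    (hψ_invHess : DifferentiableOn ℝ (MirroredStein.invHess ψ) (interior Θ))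
    -- `∇ log p_H` is `L`-Lipschitz
    (L : ℝ≥0)
    (hL : LipschitzWith L
      (gradient fun η => Real.log (MirroredStein.mirroredDensity Θ p ψ η)))
    -- the matrix-valued kernel `K` and its RKHS `H`
    (K : EuclideanSpace ℝ (Fin d) → EuclideanSpace ℝ (Fin d) →
      (EuclideanSpace ℝ (Fin d) →L[ℝ] EuclideanSpace ℝ (Fin d)))
    {H : Type*} [NormedAddCommGroup H] [InnerProductSpace ℝ H] [CompleteSpace H]
    [RKHS ℝ H (interior Θ) (EuclideanSpace ℝ (Fin d))]
    (hK_kernel : ∀ θ θ' : interior Θ, RKHS.kernel H θ θ' = K θ θ')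
    (hK_smooth : MirroredStein.MixedC1 (interior Θ) K)
    -- `κ₁ < ∞` and `κ₂ < ∞`
    (hκ₁ : BddAbove ((fun θ => ‖K θ θ‖) '' interior Θ))
    (hκ₂ : ∀ i, BddAbove ((fun θ => ‖MirroredStein.mixedPartial K i i θ θ‖) '' interior Θ))
    -- the current distribution
    (q : Measure (EuclideanSpace ℝ (Fin d))) [IsProbabilityMeasure q]
    (hq : InformationTheory.klDiv q (MirroredStein.target Θ p) ≠ ∞)
    -- the step size
    (ε : ℝ) (hε : 0 < ε)
    (hε_small : ENNReal.ofReal ε < 1 / (2 * ⨆ θ ∈ interior Θ,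
      ‖MirroredStein.invHess ψ θ ∘L
          MirroredStein.gradField (MirroredStein.direction p ψ K q) θ
        + ContinuousLinearMap.adjoint
            (MirroredStein.gradField (MirroredStein.direction p ψ K q) θ) ∘L
          MirroredStein.invHess ψ θ‖ₑ)) :
    -- all the quantities in the inequality are well defined and finite
    (∀ f : H, Integrable (MirroredStein.steinOp p ψ (MirroredStein.toField f)) q) ∧
    BddAbove (MirroredStein.steinValues H p ψ q) ∧
    IsProbabilityMeasure (MirroredStein.update Θ p ψ K ε q) ∧
    InformationTheory.klDiv (MirroredStein.update Θ p ψ K ε q)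
      (MirroredStein.target Θ p) ≠ ∞ ∧
    (InformationTheory.klDiv (MirroredStein.update Θ p ψ K ε q)
        (MirroredStein.target Θ p)).toReal
      - (InformationTheory.klDiv q (MirroredStein.target Θ p)).toReal
      ≤ -(ε - ((L : ℝ) * MirroredStein.kappa₁ (interior Θ) K / 2
            + 2 * MirroredStein.kappa₂ (interior Θ) K / α ^ 2) * ε ^ 2)
          * MirroredStein.mksd H p ψ q ^ 2 := by
  have h : MirroredStein.IsMirroredTarget Θ p ψ α :=
    { closed := hΘ_closed
      convex := hΘ_convex
      nonempty := MirroredStein.interior_nonempty_of_target hΘ_convex hp_prob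
      pos := hα
      strongConvex := hψ_convex
      smooth := hψ_smooth
      contDiff := hψ_C2
      prob := hp_prob
      density_pos := hp_pos
      density_diff := hp_diff
      invHess_diff := hψ_invHess }
  have hM := h.toIsMirror
  have hK : MirroredStein.IsBoundedC1Kernel Θ H K := ⟨hK_kernel, hK_smooth, hκ₁, hκ₂⟩
  have hL' : LipschitzWith L (gradient (MirroredStein.logMirrored Θ p ψ)) := hL
  have hgibbs := h.isProbabilityMeasure_gibbs
  have hmem := h.ae_mem_interior hq
  let T := gradient (MirroredStein.conjugate Θ ψ)
  have hT : MeasurableEmbedding T := hM.measurableEmbedding_gradient_conjugate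
  let Q := q.map (gradient ψ)
  have hQprob : IsProbabilityMeasure Q :=
    Measure.isProbabilityMeasure_map (MirroredStein.measurable_gradient ψ).aemeasurable
  have hQT : Q.map T = q := hM.map_gradient_conjugate_map_gradient hmem
  have hklQ : InformationTheory.klDiv q (MirroredStein.target Θ p)
      = InformationTheory.klDiv Q (MirroredStein.gibbs (MirroredStein.logMirrored Θ p ψ)) := by
    rw [← h.klDiv_map_target, hQT]
  have hQ : InformationTheory.klDiv Q
      (MirroredStein.gibbs (MirroredStein.logMirrored Θ p ψ)) ≠ ∞ := hklQ ▸ hq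
  have hint := hK.integrable_mirrored h hL' hQ
  obtain ⟨g, hg⟩ := hK.exists_representer h hL' hQ
  have hstein : ∀ f : H, MirroredStein.steinOp p ψ (MirroredStein.toField f) ∘ T
      = fun η => ⟪gradient (MirroredStein.logMirrored Θ p ψ) η,
          MirroredStein.mirroredField ψ f η⟫_ℝ
        + MirroredStein.opTrace (fderiv ℝ (MirroredStein.mirroredField ψ f) η) :=
    fun f => funext fun η => hK.steinOp_toField h f η
  have hgq : ∀ f : H, ∫ θ, MirroredStein.steinOp p ψ (MirroredStein.toField f) θ ∂q
      = ⟪g, f⟫_ℝ := by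
    intro f
    rw [← hg f, ← hQT, hT.integral_map]
    exact congrArg (fun F => ∫ η, F η ∂Q) (hstein f)
  have hgreat := MirroredStein.isGreatest_steinValues hgq
  have hmksd : MirroredStein.mksd H p ψ q = ‖g‖ := hgreat.csSup_eq
  have hdir : ∀ θ ∈ interior Θ, MirroredStein.direction p ψ K q θ = MirroredStein.toField g θ :=
    fun θ hθ => hK.direction_eq_toField hmem hgq hθ
  let W := ε • MirroredStein.mirroredField ψ g
  have hdiff := hK.differentiable_mirroredField hM g
  have hW : Differentiable ℝ W := hdiff.const_smul ε
  have hWderiv : ∀ η, fderiv ℝ W η = ε • fderiv ℝ (MirroredStein.mirroredField ψ g) η :=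
    fun η => fderiv_const_smul (hdiff η) ε
  have hWapp : ∀ η, W η = ε • MirroredStein.mirroredField ψ g η := fun _ => rfl
  have hupd : MirroredStein.update Θ p ψ K ε q = (Q.map fun η => η + W η).map T :=
    hM.update_eq hK hmem hdir ε
  have hφm : Measurable fun η => η + W η := (continuous_id.add hW.continuous).measurable
  have hφprob : IsProbabilityMeasure (Q.map fun η => η + W η) :=
    Measure.isProbabilityMeasure_map hφm.aemeasurable
  have hSW : (fun η => ⟪gradient (MirroredStein.logMirrored Θ p ψ) η, W η⟫_ℝ
        + MirroredStein.opTrace (fderiv ℝ W η))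
      = fun η => ε * (⟪gradient (MirroredStein.logMirrored Θ p ψ) η,
          MirroredStein.mirroredField ψ g η⟫_ℝ
        + MirroredStein.opTrace (fderiv ℝ (MirroredStein.mirroredField ψ g) η)) := by
    ext η
    rw [hWderiv, MirroredStein.opTrace_smul, hWapp, real_inner_smul_right]
    ring
  -- Both second-order constants carry ‖g‖², that is MKSD², which lets it factor out of the final
  -- bound.
  have hmain := MirroredStein.klDiv_map_id_add_le h.hasGradientAt_logMirrored hL' hQ (W := W)
    (C₁ := ε ^ 2 * (MirroredStein.kappa₁ (interior Θ) K * ‖g‖ ^ 2))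
    (C₂ := ε ^ 2 * (MirroredStein.kappa₂ (interior Θ) K / α ^ 2 * ‖g‖ ^ 2)) hW
    (MirroredStein.abs_inner_fderiv_le_of_step (h := hM) hK hdir hε hε_small)
    (fun η => by
      rw [hWapp, norm_smul, mul_pow, Real.norm_eq_abs, sq_abs]
      exact mul_le_mul_of_nonneg_left (hK.norm_mirroredField_sq_le hM g η) (sq_nonneg ε))
    (fun η => by
      rw [hWderiv, MirroredStein.hsSq_smul]
      exact mul_le_mul_of_nonneg_left (hK.hsSq_fderiv_mirroredField_le hM g η) (sq_nonneg ε))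
    (hSW ▸ (hint g).const_mul ε)
  -- The first-order term is the Stein functional at its own representer: ε⟪g, g⟫.
  rw [hSW, integral_const_mul, hg, real_inner_self_eq_norm_sq] at hmain
  have hklupd : InformationTheory.klDiv (MirroredStein.update Θ p ψ K ε q)
      (MirroredStein.target Θ p) = InformationTheory.klDiv (Q.map fun η => η + W η)
        (MirroredStein.gibbs (MirroredStein.logMirrored Θ p ψ)) := by
    rw [hupd, h.klDiv_map_target]
  refine ⟨fun f => ?_, ⟨‖g‖, hgreat.2⟩, ?_, ?_, ?_⟩
  · rw [← hQT, hT.integrable_map_iff, hstein]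
    exact hint f
  · rw [hupd]
    exact Measure.isProbabilityMeasure_map hT.measurable.aemeasurable
  · rw [hklupd]
    exact hmain.1
  · rw [hklupd, hklQ, hmksd]
    refine hmain.2.trans (le_of_eq ?_)
    ring
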